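/- **Setting.** Let $\mathcal S,\mathcal A$ be finite non-empty sets with $S=|\mathcal S|$, $A=|\mathcal A|$, let $H,K\ge 1$ be integers, $T=KH$, $\beta\in\mathbb R\setminus\{0\}$. An episodic MDP is given by transition kernels $P_h(\cdot\mid s,a)$ on $\mathcal S$ and deterministic rewards $r_h(s,a)\in[0,1]$, $h=1,\dots,H$. For a distribution $F$ on $\mathbb R$ put $U_\beta(F)=\frac1\beta\log\int e^{\beta x}\,dF(x)$ (entropic risk measure, EntRM). For a deterministic policy $\pi=(\pi_h)_{h\le H}$, $\pi_h:\mathcal S\to\mathcal A$, let $V_1^\pi(s)$ be $U_\beta$ of the law of the return $\sum_{h=1}^H r_h(s_h,a_h)$, where $s_1=s$, $a_h=\pi_h(s_h)$, $s_{h+1}\sim P_h(\cdot\mid s_h,a_h)$, and let $V_1^*(s)=\max_\pi V_1^\pi(s)$. The learner plays $K$ episodes. In episode $k$ it chooses a policy $\pi^k$ as a function of the previous episodes; Nature chooses the initial state $s_1^k$ arbitrarily (possibly at random and depending on the past), and the episode $s_1^k,a_1^k,\dots,s_H^k,a_H^k,s_{H+1}^k$ is played with $\pi^k$. The regret is $\mathrm{Regret}(K)=\sum_{k=1}^K\big(V_1^*(s_1^k)-V_1^{\pi^k}(s_1^k)\big)$.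 **Algorithm RODI-MF** (input $T$ and $\delta\in(0,1)$). Put $\iota=\log(SAT/\delta)$. Distributions are identified with their CDFs, and for a CDF $F$ supported on $[a,b]$ and $c\ge 0$ put $(\mathrm O^\infty_cF)(x)=[F(x)-c\,\mathbb 1_{[a,b)}(x)]^+$. In episode $k$, let $N_h(s,a)$ be the number of earlier episodes $\tau<k$ with $(s_h^\tau,a_h^\tau)=(s,a)$, and $c_h(s,a)=\sqrt{\frac{2S}{N_h(s,a)\vee 1}\,\iota}$. Starting from $\nu_{H+1}(s)=\delta_0$, compute for $h=H,\dots,1$ $$\hat\eta_h(s,a)=\begin{cases}\frac1{N_h(s,a)}\sum_{\tau<k}\mathbb 1\{(s_h^\tau,a_h^\tau)=(s,a)\}\,\nu_{h+1}(s_{h+1}^\tau)(\cdot-r_h(s,a)),&N_h(s,a)>0,\\ \delta_{H+1-h},&N_h(s,a)=0,\end{cases}$$ $$\eta_h(s,a)=\mathrm O^\infty_{c_h(s,a)}\hat\eta_h(s,a),\qquad \pi_h(s)\in\arg\max_a U_\beta(\eta_h(s,a)),\qquad \nu_h(s)=\eta_h(s,\pi_h(s)),$$ and play $\pi^k=\pi$.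 Ties in the $\arg\max$ are broken arbitrarily. For $N_h(s,a)>0$ the interval $[a,b]$ used by $\mathrm O^\infty$ at $(h,s,a)$ may be any fixed interval with $[r_h(s,a),\,r_h(s,a)+H-h]\subseteq[a,b]\subseteq[0,H+1-h]$ (for instance $[0,H+1-h]$); for $N_h(s,a)=0$ it is $[0,H+1-h]$. **Theorem.** Let $L_H=\frac{\exp(|\beta|H)-1}{|\beta|}$. This is the Lipschitz constant of $U_\beta$ over the distributions supported on $[0,H]$: it is the least $L\ge0$ such that $|U_\beta(F)-U_\beta(G)|\le L\,\|F-G\|_\infty$ for all such $F,G$, where $\|F-G\|_\infty=\sup_x|F(x)-G(x)|$. Moreover, there is a universal constant $C>0$ such that for every such MDP, every $H,K\ge1$, every $\beta\ne0$ of either sign, every $\delta\in(0,1)$ and every behaviour of Nature, with probability at least $1-\delta$ the regret of RODI-MF satisfies $$\mathrm{Regret}(K)\le C\,L_H\,H\sqrt{S^2AK\iota}= C\,\frac{\exp(|\beta|H)-1}{|\beta|}\,H\sqrt{S^2AK}\cdot\sqrt{\log(SAT/\delta)},$$ i.e. $\mathrm{Regret}(K)=\tilde{\mathcal O}\Big(\frac{\exp(|\beta|H)-1}{|\beta|}H\sqrt{S^2AK}\Big)$,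 where $\tilde{\mathcal O}$ omits the logarithmic factor. -/

import Mathlib

/-! ### Distribution functions with bounded support and the entropic risk measure -/

/-- `CDFOn a b`: the cumulative distribution functions of the probability distributions supported
on `[a, b]`, i.e. monotone right-continuous functions that vanish on `(-∞, a)` and equal `1` on
`[b, ∞)`. -/
structure CDFOn (a b : ℝ) extends StieltjesFunction ℝ where
  zero_of_lt : ∀ x, x < a → toFun x = 0
  one_of_le : ∀ x, b ≤ x → toFun x = 1

namespace CDFOn

variable {a b : ℝ}

/-- The value `F(x)` of the distribution function. -/
def val (F : CDFOn a b) (x : ℝ) : ℝ := F.toStieltjesFunction x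

lemma val_mono (F : CDFOn a b) : Monotone F.val := F.toStieltjesFunction.mono

lemma val_right_continuous (F : CDFOn a b) (x : ℝ) :
    ContinuousWithinAt F.val (Set.Ici x) x := F.toStieltjesFunction.right_continuous x

lemma val_of_lt (F : CDFOn a b) {x : ℝ} (h : x < a) : F.val x = 0 := F.zero_of_lt x h

lemma val_of_le (F : CDFOn a b) {x : ℝ} (h : b ≤ x) : F.val x = 1 := F.one_of_le x h

lemma val_nonneg (F : CDFOn a b) (x : ℝ) : 0 ≤ F.val x := by
  have h := F.val_mono (min_le_left x (a - 1))
  rwa [F.val_of_lt (lt_of_le_of_lt (min_le_right x (a - 1)) (by linarith))] at h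

lemma val_le_one (F : CDFOn a b) (x : ℝ) : F.val x ≤ 1 := by
  have h := F.val_mono (le_max_left x b)
  rwa [F.val_of_le (le_max_right x b)] at h

/-- The probability measure on `ℝ` whose distribution function is `F`. -/
noncomputable def law (F : CDFOn a b) : MeasureTheory.Measure ℝ := F.toStieltjesFunction.measure

/-- Supremum distance `‖F - G‖_∞` of two distribution functions. -/
noncomputable def supDist (F G : CDFOn a b) : ℝ := ⨆ x : ℝ, |F.val x - G.val x|

/-- The same distribution, viewed as supported on a larger interval. -/
def widen {a' b' : ℝ} (ha : a' ≤ a) (hb : b ≤ b') (F : CDFOn a b) : CDFOn a' b' where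
  toStieltjesFunction := F.toStieltjesFunction
  zero_of_lt x hx := F.zero_of_lt x (hx.trans_le ha)
  one_of_le x hx := F.one_of_le x (hb.trans hx)

/-- The distribution function `1{x ≥ b}` of the Dirac measure at `b`, on `[a, b]`. -/
noncomputable def diracRight (a b : ℝ) (hab : a ≤ b) : CDFOn a b where
  toFun x := if b ≤ x then 1 else 0
  mono' x y hxy := by
    by_cases hx : b ≤ x
    · simp [hx, hx.trans hxy]
    · simp only [hx, if_false]; split_ifs <;> norm_num
  right_continuous' x := by
    by_cases hx : b ≤ x
    · refine (continuousWithinAt_const (b := (1 : ℝ))).congr (fun y hy => ?_) ?_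
      · simp [hx.trans (Set.mem_Ici.1 hy)]
      · simp [hx]
    · refine (continuousAt_const (y := (0 : ℝ)).congr ?_).continuousWithinAt
      filter_upwards [Iio_mem_nhds (not_le.1 hx)] with y hy
      simp [not_le.2 (Set.mem_Iio.1 hy)]
  zero_of_lt x hx := by simp [not_le.2 (hx.trans_le hab)]
  one_of_le x hx := by simp [hx]

/-- The shifted distribution `F(· - c)`. -/
def shift (c : ℝ) (F : CDFOn a b) : CDFOn (c + a) (c + b) where
  toFun x := F.val (x - c)
  mono' x y hxy := F.val_mono (by linarith)
  right_continuous' x :=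
    (F.val_right_continuous (x - c)).comp (f := fun y : ℝ => y - c) (s := Set.Ici x)
      (by fun_prop) (fun y hy => Set.mem_Ici.2 (sub_le_sub_right (Set.mem_Ici.1 hy) c))
  zero_of_lt x hx := F.val_of_lt (by linarith)
  one_of_le x hx := F.val_of_le (by linarith)

/-- The mixture `∑ₛ p(s) ν(s)`. -/
noncomputable def mix {S : Type*} [Fintype S] (p : PMF S) (ν : S → CDFOn a b) : CDFOn a b where
  toFun x := ∑ s, (p s).toReal * (ν s).val x
  mono' x y hxy := Finset.sum_le_sum fun s _ =>
    mul_le_mul_of_nonneg_left ((ν s).val_mono hxy) ENNReal.toReal_nonneg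
  right_continuous' x := by
    have h : ∀ s ∈ (Finset.univ : Finset S),
        ContinuousWithinAt (fun x => (p s).toReal * (ν s).val x) (Set.Ici x) x :=
      fun s _ => continuousWithinAt_const.mul ((ν s).val_right_continuous x)
    exact tendsto_finsetSum _ h
  zero_of_lt x hx := Finset.sum_eq_zero fun s _ => by rw [(ν s).val_of_lt hx, mul_zero]
  one_of_le x hx := by
    have h : ∑ s, (p s).toReal = 1 := by
      have h1 : ∑ s, p s = 1 := by rw [← p.tsum_coe, tsum_fintype]
      rw [← ENNReal.toReal_sum (fun s _ => p.apply_ne_top s), h1, ENNReal.toReal_one]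
    rw [← h]
    exact Finset.sum_congr rfl fun s _ => by rw [(ν s).val_of_le hx, mul_one]

/-- The distributional optimism operator at level `c ≥ 0` on the distributions supported on
`[a, b]`: `x ↦ [F(x) - c 1{x ∈ [a, b)}]⁺`. -/
noncomputable def optimism (c : ℝ) (hc : 0 ≤ c) (F : CDFOn a b) : CDFOn a b where
  toFun x := max (F.val x - c * (Set.Ico a b).indicator (fun _ => (1 : ℝ)) x) 0
  mono' x y hxy := by
    rcases lt_or_ge x a with hx | hx
    · have hx' : x ∉ Set.Ico a b := fun h => (not_le.2 hx) h.1
      simp [F.val_of_lt hx, hx']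
    rcases lt_or_ge y b with hy | hy
    · have hx' : x ∈ Set.Ico a b := ⟨hx, hxy.trans_lt hy⟩
      have hy' : y ∈ Set.Ico a b := ⟨hx.trans hxy, hy⟩
      simp only [Set.indicator_of_mem hx', Set.indicator_of_mem hy']
      exact max_le_max (by linarith [F.val_mono hxy]) le_rfl
    · have hy' : y ∉ Set.Ico a b := fun h => (not_lt.2 hy) h.2
      simp only [Set.indicator_of_notMem hy', F.val_of_le hy, mul_zero, sub_zero]
      refine max_le_max ?_ le_rfl
      have h0 : 0 ≤ c * (Set.Ico a b).indicator (fun _ => (1 : ℝ)) x :=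
        mul_nonneg hc (Set.indicator_nonneg (fun _ _ => zero_le_one) x)
      linarith [F.val_le_one x]
  right_continuous' x := by
    have hind : ContinuousWithinAt ((Set.Ico a b).indicator (fun _ => (1 : ℝ))) (Set.Ici x) x := by
      rcases lt_or_ge x a with hx | hx
      · refine (continuousAt_const (y := (0 : ℝ)).congr ?_).continuousWithinAt
        filter_upwards [Iio_mem_nhds hx] with y hy
        rw [Set.indicator_of_notMem fun h => (not_le.2 hy) h.1]
      rcases lt_or_ge x b with hxb | hxb
      · refine (continuousWithinAt_const (b := (1 : ℝ))).congr_of_eventuallyEq ?_ ?_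
        · filter_upwards [self_mem_nhdsWithin, mem_nhdsWithin_of_mem_nhds (Iio_mem_nhds hxb)]
            with y hy hyb
          exact Set.indicator_of_mem (s := Set.Ico a b) ⟨hx.trans hy, hyb⟩ _
        · exact Set.indicator_of_mem (s := Set.Ico a b) ⟨hx, hxb⟩ _
      · refine (continuousWithinAt_const (b := (0 : ℝ))).congr (fun y hy => ?_) ?_
        · rw [Set.indicator_of_notMem fun h => (not_lt.2 (hxb.trans hy)) h.2]
        · rw [Set.indicator_of_notMem fun h => (not_lt.2 hxb) h.2]
    exact ((F.val_right_continuous x).sub (continuousWithinAt_const.mul hind)).max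
      continuousWithinAt_const
  zero_of_lt x hx := by
    have hx' : x ∉ Set.Ico a b := fun h => (not_le.2 hx) h.1
    simp [F.val_of_lt hx, hx']
  one_of_le x hx := by
    have hx' : x ∉ Set.Ico a b := fun h => (not_lt.2 hx) h.2
    simp [F.val_of_le hx, hx']

end CDFOn

/-- Entropic risk measure `U_β(μ) = β⁻¹ log ∫ e^{βx} dμ(x)` of a distribution `μ` on `ℝ`. -/
noncomputable def entRM (β : ℝ) (μ : MeasureTheory.Measure ℝ) : ℝ :=
  1 / β * Real.log (∫ x, Real.exp (β * x) ∂μ)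

/-- `L_H = (e^{|β| H} - 1) / |β|`. -/
noncomputable def lipConst (β : ℝ) (H : ℕ) : ℝ := (Real.exp (|β| * H) - 1) / |β|

/-! ### Episodic MDPs

Steps are numbered `0, …, H - 1`; for a step `h : Fin H`, the number of steps after `h` is
`(h.rev : ℕ) = H - 1 - h`. -/

/-- An episodic MDP of horizon `H` with deterministic rewards in `[0, 1]`. -/
structure EpisodicMDP (S A : Type*) (H : ℕ) where
  /-- transition kernels -/
  P : Fin H → S → A → PMF S
  /-- rewards -/
  r : Fin H → S → A → ℝ
  r_nonneg : ∀ h s a, 0 ≤ r h s a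
  r_le_one : ∀ h s a, r h s a ≤ 1

/-- Deterministic (time-dependent, Markov) policies. -/
abbrev Policy (S A : Type*) (H : ℕ) := Fin H → S → A

/-- What is observed in one episode: the states `s_0, …, s_H` and the actions `a_0, …, a_{H-1}`. -/
structure Episode (S A : Type*) (H : ℕ) where
  states : Fin (H + 1) → S
  actions : Fin H → A

/-- The history of the past episodes, the most recent one first. -/
abbrev History (S A : Type*) (H : ℕ) := List (Episode S A H)

namespace EpisodicMDP

variable {S A : Type*} {H : ℕ}

/-- Law of the first `m + 1` states of an episode started at `s₁` and played with policy `π`. -/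
noncomputable def statesLaw (M : EpisodicMDP S A H) (π : Policy S A H) (s₁ : S) :
    (m : ℕ) → m ≤ H → PMF (Fin (m + 1) → S)
  | 0, _ => PMF.pure fun _ => s₁
  | m + 1, hm =>
    (M.statesLaw π s₁ m (Nat.le_of_succ_le hm)).bind fun x =>
      (M.P ⟨m, hm⟩ (x (Fin.last m)) (π ⟨m, hm⟩ (x (Fin.last m)))).map fun s' =>
        Fin.snoc (α := fun _ => S) x s'

/-- Law of an episode started at `s₁` and played with policy `π`. -/
noncomputable def episodeLaw (M : EpisodicMDP S A H) (π : Policy S A H) (s₁ : S) :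
    PMF (Episode S A H) :=
  (M.statesLaw π s₁ H le_rfl).map fun x => ⟨x, fun h => π h (x h.castSucc)⟩

/-- The return `∑ₕ rₕ(sₕ, aₕ)` of an episode. -/
noncomputable def totalReward (M : EpisodicMDP S A H) (e : Episode S A H) : ℝ :=
  ∑ h : Fin H, M.r h (e.states h.castSucc) (e.actions h)

/-- Value `V^π(s)` at the first step: entropic risk of the law of the return. -/
noncomputable def value (M : EpisodicMDP S A H) (β : ℝ) (π : Policy S A H) (s : S) : ℝ :=
  entRM β ((M.episodeLaw π s).map M.totalReward).toMeasure

/-- Optimal value `V^*(s)` at the first step. -/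
noncomputable def optValue (M : EpisodicMDP S A H) (β : ℝ) (s : S) : ℝ :=
  ⨆ π : Policy S A H, M.value β π s

/-- Law of the history after `K` episodes, when the learner plays in each episode the policy `alg`
computed from the past, and Nature draws the initial state from an arbitrary law, given the past. -/
noncomputable def runLaw (M : EpisodicMDP S A H) (nature : History S A H → PMF S)
    (alg : History S A H → Policy S A H) : ℕ → PMF (History S A H)
  | 0 => PMF.pure []
  | k + 1 => (M.runLaw nature alg k).bind fun hist =>
      (nature hist).bind fun s₁ => (M.episodeLaw (alg hist) s₁).map fun e => e :: hist

/-- The regret `∑ₖ V^*(s₁ᵏ) - V^{πᵏ}(s₁ᵏ)` of a history. -/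
noncomputable def regret (M : EpisodicMDP S A H) (β : ℝ) (alg : History S A H → Policy S A H) :
    History S A H → ℝ
  | [] => 0
  | e :: hist =>
      M.regret β alg hist + (M.optValue β (e.states 0) - M.value β (alg hist) (e.states 0))

end EpisodicMDP

/-! ### The algorithm -/

section RODIMF

variable {S A : Type*} {H : ℕ}

/-- A choice, for all `(h, s, a)`, of the interval `[lo, hi]` on which the optimism operator acts
at `(h, s, a)`. It contains `[r, r + H - 1 - h]`, where the backed-up return distribution lives,
and is contained in the range `[0, H - h]` of the returns from step `h` on. -/
structure SupportWindow (M : EpisodicMDP S A H) where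
  lo : Fin H → S → A → ℝ
  hi : Fin H → S → A → ℝ
  lo_nonneg : ∀ h s a, 0 ≤ lo h s a
  lo_le : ∀ h s a, lo h s a ≤ M.r h s a
  le_hi : ∀ h s a, M.r h s a + ((h.rev : ℕ) : ℝ) ≤ hi h s a
  hi_le : ∀ h s a, hi h s a ≤ ((h.rev : ℕ) : ℝ) + 1

/-- The largest window, `[0, H - h]`. -/
def SupportWindow.full (M : EpisodicMDP S A H) : SupportWindow M where
  lo _ _ _ := 0
  hi h _ _ := ((h.rev : ℕ) : ℝ) + 1
  lo_nonneg _ _ _ := le_rfl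
  lo_le h s a := M.r_nonneg h s a
  le_hi h s a := by linarith [M.r_le_one h s a]
  hi_le _ _ _ := le_rfl

/-- The smallest window, `[r, r + H - 1 - h]`. -/
def SupportWindow.tight (M : EpisodicMDP S A H) : SupportWindow M where
  lo h s a := M.r h s a
  hi h s a := M.r h s a + ((h.rev : ℕ) : ℝ)
  lo_nonneg h s a := M.r_nonneg h s a
  lo_le _ _ _ := le_rfl
  le_hi _ _ _ := le_rfl
  hi_le h s a := by linarith [M.r_le_one h s a]

open Classical in
/-- The past episodes in which the action `a` was taken in the state `s` at step `h`. -/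
noncomputable def visits (hist : History S A H) (h : Fin H) (s : S) (a : A) :
    List (Episode S A H) :=
  hist.filter fun e => e.states h.castSucc = s ∧ e.actions h = a

/-- The states reached from `s` at step `h` by taking `a`, with multiplicity. -/
noncomputable def nextStates (hist : History S A H) (h : Fin H) (s : S) (a : A) : Multiset S :=
  ((visits hist h s a).map fun e => e.states h.succ : List S)

/-- `N_h(s, a)`. -/
noncomputable def visitCount (hist : History S A H) (h : Fin H) (s : S) (a : A) : ℕ :=
  (visits hist h s a).length

lemma nextStates_ne_zero {hist : History S A H} {h : Fin H} {s : S} {a : A}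
    (hN : 0 < visitCount hist h s a) : nextStates hist h s a ≠ 0 := by
  intro h0
  have := congrArg Multiset.card h0
  simp [nextStates, visitCount] at this hN
  simp [this] at hN

/-- The optimism constant `c_h(s, a) = √(2 S ι / (N_h(s, a) ∨ 1))`. -/
noncomputable def bonus [Fintype S] (iota : ℝ) (hist : History S A H) (h : Fin H) (s : S) (a : A) :
    ℝ :=
  Real.sqrt (2 * (Fintype.card S : ℝ) / (max (visitCount hist h s a) 1 : ℕ) * iota)

lemma bonus_nonneg [Fintype S] (iota : ℝ) (hist : History S A H) (h : Fin H) (s : S) (a : A) :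
    0 ≤ bonus iota hist h s a := Real.sqrt_nonneg _

open Classical in
/-- The optimistic return distribution `η_h(s, a)`, for the step `h` that is followed by `n` more
steps, computed from the return distributions `ν` of the next step. If `(s, a)` has been visited at
step `h`, it is the optimism operator applied to the empirical distributional Bellman backup
`N⁻¹ ∑_τ 1{(s_h^τ, a_h^τ) = (s, a)} ν(s_{h+1}^τ)(· - r_h(s, a))`, which is the shift by `r_h(s, a)`
of the mixture of `ν` under the empirical transition probabilities; otherwise, it is the optimism
operator applied to the Dirac mass at `n + 1`. -/
noncomputable def optimisticBackup [Fintype S] (M : EpisodicMDP S A H) (W : SupportWindow M)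
    (iota : ℝ) (hist : History S A H) (n : ℕ) (hn : n < H) (ν : S → CDFOn 0 (n : ℝ))
    (s : S) (a : A) : CDFOn 0 ((n + 1 : ℕ) : ℝ) :=
  let h : Fin H := Fin.rev ⟨n, hn⟩
  let c := bonus iota hist h s a
  let hc := bonus_nonneg iota hist h s a
  if hN : 0 < visitCount hist h s a then
    ((((CDFOn.mix (PMF.ofMultiset _ (nextStates_ne_zero hN)) ν).shift (M.r h s a)).widen
      (a' := W.lo h s a) (b' := W.hi h s a)
      (by simpa using W.lo_le h s a)
      (by simpa [h] using W.le_hi h s a)).optimism c hc).widen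
        (W.lo_nonneg h s a) (by simpa [h] using W.hi_le h s a)
  else
    (CDFOn.diracRight 0 ((n + 1 : ℕ) : ℝ) (Nat.cast_nonneg _)).optimism c hc

/-- The optimistic return distributions `ν_h(s) = η_h(s, π_h(s))`, by backward recursion; the
argument `n` is the number of remaining steps, and `n = 0` is the end of the episode. -/
noncomputable def plannedReturn [Fintype S] (M : EpisodicMDP S A H) (W : SupportWindow M)
    (iota : ℝ) (hist : History S A H) (π : Policy S A H) :
    (n : ℕ) → n ≤ H → S → CDFOn 0 (n : ℝ)
  | 0, _ => fun _ => CDFOn.diracRight 0 ((0 : ℕ) : ℝ) (Nat.cast_nonneg _)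
  | n + 1, hn => fun s =>
      optimisticBackup M W iota hist n hn
        (plannedReturn M W iota hist π n (Nat.le_of_succ_le hn)) s (π (Fin.rev ⟨n, hn⟩) s)

/-- `π` is an output of the planning phase: for all `h` and `s`, the action `π_h(s)` maximizes the
entropic risk `U_β(η_h(s, a))` over `a`. -/
def IsPlannedPolicy [Fintype S] (M : EpisodicMDP S A H) (W : SupportWindow M) (β iota : ℝ)
    (hist : History S A H) (π : Policy S A H) : Prop :=
  ∀ (n : ℕ) (hn : n < H) (s : S) (a : A),
    entRM β (optimisticBackup M W iota hist n hn
        (plannedReturn M W iota hist π n hn.le) s a).law ≤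
      entRM β (optimisticBackup M W iota hist n hn
        (plannedReturn M W iota hist π n hn.le) s (π (Fin.rev ⟨n, hn⟩) s)).law

/-- `alg` is RODI-MF, with some rule for breaking ties in the maximization over the actions. -/
def IsRODIMF [Fintype S] (M : EpisodicMDP S A H) (W : SupportWindow M) (β iota : ℝ)
    (alg : History S A H → Policy S A H) : Prop :=
  ∀ hist, IsPlannedPolicy M W β iota hist (alg hist)

end RODIMF

/-- `ι = log (S A T / δ)` with `T = K H`. -/
noncomputable def logFactor (S A : Type*) [Fintype S] [Fintype A] (H K : ℕ) (δ : ℝ) : ℝ :=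
  Real.log ((Fintype.card S : ℝ) * Fintype.card A * (K * H) / δ)

/-! Lipschitz constant. Integration by parts gives `∫ e^{βx} dF = e^{βH} - β ∫ e^{βx} F(x) dx` over
`[0, H]`, so the exponential moment moves by at most `|e^{βH} - 1|` times the sup distance. The
moment is at least `min 1 e^{βH}`, which bounds the slope of the logarithm, and the two factors
combine to `L_H` for either sign of `β`. A small mass moved from the endpoint of smaller moment to
the other one shows sharpness (`isLeast_lipConst`).

Regret. Comparisons of entropic risk are comparisons of `1/β` times the exponential moment. This
quantity is linear in mixtures, is multiplied by a positive factor under shifts, and decreases when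
the CDF increases pointwise. Suppose every empirical transition law is within its bonus of the truth
in total variation. Then lowering the empirical CDF by the bonus puts it below the true Bellman
backup, and backward induction makes the plan optimistic (`IsAccurate.expMoment_returnDist_le`).

The regret of an episode is then at most the risk of the planned return minus that of the true
return under the same policy. The sup distance of these two distributions obeys `G_{n+1} = min 1 (2c
+ P G_n)` (`planningGap`). The Lipschitz bound is applied only once, to the full returns, so `L_H`
is paid once.

Since `G` takes values in `[0, 1]`, an exponential supermartingale with Hoeffding cost `t²/8` per
step compares `∑ G` with the bonuses met along the trajectories, up to `√(KHι)`
(`runLaw_cumGap_ge_le`). The bonuses sum to `O(H √(S²AKι))` by telescoping `1/√N` and Cauchy-Schwarz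
(`cumBonus_le`). Accuracy at all stages follows from another exponential supermartingale and a union
bound (`runLaw_not_isAccurate_le`). -/

open scoped ENNReal

/-! ### Discrete expectations, Markov's inequality and Hoeffding's lemma. -/

namespace PMF

/-- Expectation of a `[0, ∞]`-valued function under a probability mass function. -/
noncomputable def lexp {α : Type*} (p : PMF α) (f : α → ℝ≥0∞) : ℝ≥0∞ := ∑' x, p x * f x

variable {α β : Type*}

lemma lexp_pure (a : α) (f : α → ℝ≥0∞) : (PMF.pure a).lexp f = f a := by
  classical
  rw [lexp, tsum_eq_single a]
  · simp
  · intro b hb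
    simp [hb]

lemma lexp_bind (p : PMF α) (q : α → PMF β) (f : β → ℝ≥0∞) :
    (p.bind q).lexp f = p.lexp fun a => (q a).lexp f := by
  simp only [lexp, PMF.bind_apply, ← ENNReal.tsum_mul_right, ← ENNReal.tsum_mul_left]
  rw [ENNReal.tsum_comm]
  simp only [mul_assoc]

lemma lexp_map (p : PMF α) (g : α → β) (f : β → ℝ≥0∞) :
    (p.map g).lexp f = p.lexp fun a => f (g a) := by
  rw [PMF.map, lexp_bind]
  simp only [Function.comp, lexp_pure]

lemma lexp_mono (p : PMF α) {f g : α → ℝ≥0∞} (h : ∀ x, f x ≤ g x) : p.lexp f ≤ p.lexp g :=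
  ENNReal.tsum_le_tsum fun x => by gcongr; exact h x

lemma lexp_const (p : PMF α) (c : ℝ≥0∞) : (p.lexp fun _ => c) = c := by
  rw [lexp, ENNReal.tsum_mul_right, p.tsum_coe, one_mul]

lemma lexp_const_mul (p : PMF α) (c : ℝ≥0∞) (f : α → ℝ≥0∞) :
    (p.lexp fun x => c * f x) = c * p.lexp f := by
  rw [lexp, lexp, ← ENNReal.tsum_mul_left]
  exact tsum_congr fun x => mul_left_comm _ _ _

lemma lexp_fintype [Fintype α] (p : PMF α) (f : α → ℝ≥0∞) : p.lexp f = ∑ x, p x * f x :=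
  tsum_fintype _

lemma toOuterMeasure_eq_lexp (p : PMF α) (s : Set α) :
    p.toOuterMeasure s = p.lexp (s.indicator 1) := by
  rw [PMF.toOuterMeasure_apply, lexp]
  refine tsum_congr fun x => ?_
  by_cases hx : x ∈ s <;> simp [hx]

/-- Markov's inequality. -/
lemma toOuterMeasure_ge_le_lexp_div (p : PMF α) (f : α → ℝ≥0∞) {c : ℝ≥0∞} (hc : c ≠ 0)
    (hc' : c ≠ ∞) : p.toOuterMeasure {x | c ≤ f x} ≤ p.lexp f / c := by
  rw [ENNReal.le_div_iff_mul_le (Or.inl hc) (Or.inl hc'), mul_comm, toOuterMeasure_eq_lexp,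
    ← lexp_const_mul]
  refine lexp_mono _ fun x => ?_
  by_cases hx : c ≤ f x <;> simp [hx]

lemma toOuterMeasure_add_compl (p : PMF α) (s : Set α) :
    p.toOuterMeasure s + p.toOuterMeasure sᶜ = 1 := by
  rw [PMF.toOuterMeasure_apply, PMF.toOuterMeasure_apply, ← ENNReal.tsum_add, ← p.tsum_coe]
  refine tsum_congr fun x => ?_
  by_cases hx : x ∈ s <;> simp [hx]

lemma sum_toReal [Fintype α] (p : PMF α) : ∑ x, (p x).toReal = 1 := by
  have h1 : ∑ x, p x = 1 := by rw [← p.tsum_coe, tsum_fintype]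
  rw [← ENNReal.toReal_sum (fun s _ => p.apply_ne_top s), h1, ENNReal.toReal_one]

lemma lexp_ofReal [Fintype α] (p : PMF α) {f : α → ℝ} (hf : ∀ x, 0 ≤ f x) :
    (p.lexp fun x => ENNReal.ofReal (f x)) = ENNReal.ofReal (∑ x, (p x).toReal * f x) := by
  rw [lexp_fintype, ENNReal.ofReal_sum_of_nonneg
    fun x _ => mul_nonneg ENNReal.toReal_nonneg (hf x)]
  refine Finset.sum_congr rfl fun x _ => ?_
  rw [ENNReal.ofReal_mul ENNReal.toReal_nonneg, ENNReal.ofReal_toReal (p.apply_ne_top x)]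

/-- Hoeffding's lemma for a function with values in an interval of length one. -/
lemma sum_mul_exp_sub_mean_le [Fintype α] (p : PMF α) (f : α → ℝ) (a : ℝ)
    (hf : ∀ x, f x ∈ Set.Icc a (a + 1)) (t : ℝ) :
    ∑ x, (p x).toReal * Real.exp (t * (f x - ∑ y, (p y).toReal * f y)) ≤
      Real.exp (t ^ 2 / 8) := by
  let _ : MeasurableSpace α := ⊤
  have : MeasurableSingletonClass α := ⟨fun _ => trivial⟩
  have h := (ProbabilityTheory.hasSubgaussianMGF_of_mem_Icc (μ := p.toMeasure) (X := f)
    (a := a) (b := a + 1) (measurable_of_finite f).aemeasurable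
    (Filter.Eventually.of_forall hf)).mgf_le t
  rw [ProbabilityTheory.mgf, PMF.integral_eq_sum, PMF.integral_eq_sum] at h
  simp only [smul_eq_mul] at h
  refine h.trans (le_of_eq ?_)
  congr 1
  simp
  ring

end PMF

/-! ### Expectations along episodes and runs. -/

namespace EpisodicMDP

variable {S A : Type*} {H : ℕ}

lemma lexp_statesLaw_succ (M : EpisodicMDP S A H) (π : Policy S A H) (s₁ : S) (m : ℕ)
    (hm : m + 1 ≤ H) (f : (Fin (m + 2) → S) → ℝ≥0∞) :
    (M.statesLaw π s₁ (m + 1) hm).lexp f =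
      (M.statesLaw π s₁ m (Nat.le_of_succ_le hm)).lexp fun x =>
        (M.P ⟨m, hm⟩ (x (Fin.last m)) (π ⟨m, hm⟩ (x (Fin.last m)))).lexp fun s' =>
          f (Fin.snoc (α := fun _ => S) x s') := by
  rw [statesLaw, PMF.lexp_bind]
  simp only [PMF.lexp_map]

/-- Only the last factor and `V` see the last state, so conditioning on the earlier ones integrates
just these. -/
lemma lexp_statesLaw_succ_prod (M : EpisodicMDP S A H) (π : Policy S A H) (s₁ : S) (m : ℕ)
    (hm : m + 1 ≤ H) (u : S → ℝ≥0∞) (w : Fin H → S → S → ℝ≥0∞) (V : S → ℝ≥0∞) :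
    ((M.statesLaw π s₁ (m + 1) hm).lexp fun x =>
      u (x 0) * (∏ i : Fin (m + 1), w (i.castLE hm) (x i.castSucc) (x i.succ)) *
        V (x (Fin.last (m + 1)))) =
    (M.statesLaw π s₁ m (Nat.le_of_succ_le hm)).lexp fun x =>
      u (x 0) * (∏ i : Fin m, w (i.castLE (Nat.le_of_succ_le hm)) (x i.castSucc) (x i.succ)) *
        (M.P ⟨m, hm⟩ (x (Fin.last m)) (π ⟨m, hm⟩ (x (Fin.last m)))).lexp fun s' =>
          w ⟨m, hm⟩ (x (Fin.last m)) s' * V s' := by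
  rw [lexp_statesLaw_succ]
  congr 1
  funext x
  rw [← PMF.lexp_const_mul]
  congr 1
  funext s'
  have h0 : (Fin.snoc (α := fun _ => S) x s' : Fin (m + 2) → S) 0 = x 0 :=
    Fin.snoc_castSucc (α := fun _ => S) s' x 0
  rw [Fin.prod_univ_castSucc]
  simp only [Fin.succ_castSucc, Fin.snoc_castSucc, Fin.succ_last, Fin.snoc_last, h0]
  have h1 : Fin.castLE hm (Fin.last m) = ⟨m, hm⟩ := rfl
  have h2 : ∀ i : Fin m, Fin.castLE hm i.castSucc = i.castLE (Nat.le_of_succ_le hm) :=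
    fun i => rfl
  simp only [h1, h2]
  ring

/-- Backward induction for multiplicative functionals of an episode. -/
lemma lexp_statesLaw_prod (M : EpisodicMDP S A H) (π : Policy S A H) (s₁ : S)
    (u : S → ℝ≥0∞) (w : Fin H → S → S → ℝ≥0∞) (V : (n : ℕ) → n ≤ H → S → ℝ≥0∞)
    (hV : ∀ (n : ℕ) (hn : n < H) (s : S),
      ((M.P (Fin.rev ⟨n, hn⟩) s (π (Fin.rev ⟨n, hn⟩) s)).lexp fun s' =>
        w (Fin.rev ⟨n, hn⟩) s s' * V n hn.le s') = V (n + 1) hn s) :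
    ∀ (m : ℕ) (hm : m ≤ H) (n : ℕ) (hn : n ≤ H), m + n = H →
      ((M.statesLaw π s₁ m hm).lexp fun x =>
        u (x 0) * (∏ i : Fin m, w (i.castLE hm) (x i.castSucc) (x i.succ)) *
          V n hn (x (Fin.last m))) = u s₁ * V H le_rfl s₁
  | 0, _, n, _, h => by
    obtain rfl : n = H := by omega
    rw [statesLaw, PMF.lexp_pure]
    simp
  | m + 1, hm, n, hn, h => by
    -- Integrating out the last state turns `V n` into `V (n + 1)`: `m` drops by one and `m + n = H`
    -- persists.
    rw [lexp_statesLaw_succ_prod,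
      ← lexp_statesLaw_prod M π s₁ u w V hV m (Nat.le_of_succ_le hm) (n + 1) (by omega) (by omega)]
    congr 1
    funext x
    have hr : (⟨m, hm⟩ : Fin H) = Fin.rev ⟨n, by omega⟩ := by
      ext; simp [Fin.val_rev]; omega
    rw [← hV n (by omega), hr]

/-- The inequality form serves the supermartingales, where Hoeffding's lemma gives only an upper
bound; the equality form computes moments of the return. -/
lemma lexp_statesLaw_prod_le (M : EpisodicMDP S A H) (π : Policy S A H) (s₁ : S)
    (u : S → ℝ≥0∞) (w : Fin H → S → S → ℝ≥0∞) (V : (n : ℕ) → n ≤ H → S → ℝ≥0∞)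
    (hV : ∀ (n : ℕ) (hn : n < H) (s : S),
      ((M.P (Fin.rev ⟨n, hn⟩) s (π (Fin.rev ⟨n, hn⟩) s)).lexp fun s' =>
        w (Fin.rev ⟨n, hn⟩) s s' * V n hn.le s') ≤ V (n + 1) hn s) :
    ∀ (m : ℕ) (hm : m ≤ H) (n : ℕ) (hn : n ≤ H), m + n = H →
      ((M.statesLaw π s₁ m hm).lexp fun x =>
        u (x 0) * (∏ i : Fin m, w (i.castLE hm) (x i.castSucc) (x i.succ)) *
          V n hn (x (Fin.last m))) ≤ u s₁ * V H le_rfl s₁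
  | 0, _, n, _, h => by
    obtain rfl : n = H := by omega
    rw [statesLaw, PMF.lexp_pure]
    simp
  | m + 1, hm, n, hn, h => by
    rw [lexp_statesLaw_succ_prod]
    refine le_trans ?_ (lexp_statesLaw_prod_le M π s₁ u w V hV m (Nat.le_of_succ_le hm) (n + 1)
      (by omega) (by omega))
    refine PMF.lexp_mono _ fun x => ?_
    have hr : (⟨m, hm⟩ : Fin H) = Fin.rev ⟨n, by omega⟩ := by
      ext; simp [Fin.val_rev]; omega
    gcongr
    refine le_trans (le_of_eq ?_) (hV n (by omega) _)
    rw [hr]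

lemma lexp_episodeLaw (M : EpisodicMDP S A H) (π : Policy S A H) (s₁ : S)
    (f : Episode S A H → ℝ≥0∞) :
    (M.episodeLaw π s₁).lexp f =
      (M.statesLaw π s₁ H le_rfl).lexp fun x => f ⟨x, fun h => π h (x h.castSucc)⟩ := by
  rw [episodeLaw, PMF.lexp_map]

/-- Backward induction for multiplicative functionals of an episode that starts at `s₁`. -/
lemma lexp_episodeLaw_prod_le (M : EpisodicMDP S A H) (π : Policy S A H) (s₁ : S)
    (u : S → ℝ≥0∞) (w : Fin H → S → A → S → ℝ≥0∞) (V : (n : ℕ) → n ≤ H → S → ℝ≥0∞)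
    (hV0 : ∀ s, V 0 (Nat.zero_le _) s = 1)
    (hV : ∀ (n : ℕ) (hn : n < H) (s : S),
      ((M.P (Fin.rev ⟨n, hn⟩) s (π (Fin.rev ⟨n, hn⟩) s)).lexp fun s' =>
        w (Fin.rev ⟨n, hn⟩) s (π (Fin.rev ⟨n, hn⟩) s) s' * V n hn.le s') ≤ V (n + 1) hn s) :
    ((M.episodeLaw π s₁).lexp fun e =>
      u (e.states 0) * ∏ h : Fin H, w h (e.states h.castSucc) (e.actions h) (e.states h.succ)) ≤
      u s₁ * V H le_rfl s₁ := by
  have h := lexp_statesLaw_prod_le M π s₁ u (fun h s s' => w h s (π h s) s') V hV H le_rfl 0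
    (Nat.zero_le _) rfl
  simp only [hV0, mul_one] at h
  rw [lexp_episodeLaw]
  exact h

lemma lexp_runLaw_succ (M : EpisodicMDP S A H) (nature : History S A H → PMF S)
    (alg : History S A H → Policy S A H) (k : ℕ) (f : History S A H → ℝ≥0∞) :
    (M.runLaw nature alg (k + 1)).lexp f = (M.runLaw nature alg k).lexp fun hist =>
      (nature hist).lexp fun s₁ => (M.episodeLaw (alg hist) s₁).lexp fun e => f (e :: hist) := by
  rw [runLaw, PMF.lexp_bind]
  simp only [PMF.lexp_bind, PMF.lexp_map]

/-- A nonnegative supermartingale has expectation at most its initial value. -/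
lemma lexp_runLaw_le (M : EpisodicMDP S A H) (nature : History S A H → PMF S)
    (alg : History S A H → Policy S A H) (Φ : History S A H → ℝ≥0∞)
    (hΦ : ∀ hist s₁, ((M.episodeLaw (alg hist) s₁).lexp fun e => Φ (e :: hist)) ≤ Φ hist) :
    ∀ k, (M.runLaw nature alg k).lexp Φ ≤ Φ []
  | 0 => by rw [runLaw, PMF.lexp_pure]
  | k + 1 => by
    rw [lexp_runLaw_succ]
    refine le_trans (PMF.lexp_mono _ fun hist => ?_) (lexp_runLaw_le M nature alg Φ hΦ k)
    exact (PMF.lexp_mono _ fun s₁ => hΦ hist s₁).trans_eq (PMF.lexp_const _ _)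

lemma length_of_mem_support_runLaw (M : EpisodicMDP S A H) (nature : History S A H → PMF S)
    (alg : History S A H → Policy S A H) :
    ∀ (k : ℕ) (hist : History S A H), hist ∈ (M.runLaw nature alg k).support → hist.length = k
  | 0, hist, h => by
    rw [runLaw, PMF.support_pure, Set.mem_singleton_iff] at h
    simp [h]
  | k + 1, hist, h => by
    rw [runLaw, PMF.mem_support_bind_iff] at h
    obtain ⟨hist', h', h⟩ := h
    rw [PMF.mem_support_bind_iff] at h
    obtain ⟨s₁, -, h⟩ := h
    rw [PMF.support_map] at h
    obtain ⟨e, -, rfl⟩ := h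
    simp [length_of_mem_support_runLaw M nature alg k hist' h']

/-- Union bound over the stages of a run. -/
lemma runLaw_exists_suffix_le (M : EpisodicMDP S A H) (nature : History S A H → PMF S)
    (alg : History S A H → Policy S A H) (B : Set (History S A H)) (p : ℝ≥0∞)
    (hB : ∀ k, (M.runLaw nature alg k).toOuterMeasure B ≤ p) :
    ∀ k, (M.runLaw nature alg k).toOuterMeasure {hist | ∃ t ∈ B, t <:+ hist} ≤ (k + 1 : ℕ) * p
  | 0 => by
    refine le_trans (PMF.toOuterMeasure_mono _ ?_) (by simpa using hB 0)
    rintro hist ⟨⟨t, ht, hs⟩, h0⟩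
    rw [runLaw, PMF.support_pure, Set.mem_singleton_iff] at h0
    subst h0
    rwa [List.suffix_nil.1 hs] at ht
  | k + 1 => by
    have hle : (M.runLaw nature alg (k + 1)).toOuterMeasure {hist | ∃ t ∈ B, t <:+ hist} ≤
        (M.runLaw nature alg (k + 1)).toOuterMeasure B +
          (M.runLaw nature alg k).toOuterMeasure {hist | ∃ t ∈ B, t <:+ hist} := by
      -- The suffixes of a history are the histories at its earlier stages. Either the whole history
      -- is bad or some suffix of its tail is; the latter event does not involve the newest episode.
      calc _ ≤ (M.runLaw nature alg (k + 1)).toOuterMeasure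
            (B ∪ {hist | ∃ t ∈ B, t <:+ hist.tail}) := by
            refine MeasureTheory.OuterMeasure.mono _ ?_
            rintro hist ⟨t, ht, hs⟩
            cases hist with
            | nil => exact Or.inl (by rwa [List.suffix_nil.1 hs] at ht)
            | cons e hist =>
              rcases List.suffix_cons_iff.1 hs with rfl | hs
              · exact Or.inl ht
              · exact Or.inr ⟨t, ht, hs⟩
        _ ≤ _ := MeasureTheory.measure_union_le _ _
        _ = _ := by
            congr 1
            rw [PMF.toOuterMeasure_eq_lexp, PMF.toOuterMeasure_eq_lexp, lexp_runLaw_succ]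
            congr 1
            funext hist
            have : ∀ e : Episode S A H,
                ({hist | ∃ t ∈ B, t <:+ hist.tail} : Set (History S A H)).indicator
                  (1 : History S A H → ℝ≥0∞) (e :: hist) =
                ({hist | ∃ t ∈ B, t <:+ hist} : Set (History S A H)).indicator 1 hist := by
              intro e
              rfl
            simp only [this, PMF.lexp_const]
    refine hle.trans ((add_le_add (hB _) (runLaw_exists_suffix_le M nature alg B p hB k)).trans
      (le_of_eq ?_))
    push_cast
    ring

end EpisodicMDP

/-! ### Exponential moments in terms of distribution functions. -/

namespace CDFOn

open MeasureTheory

variable {a b : ℝ}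

lemma left_le_right (F : CDFOn a b) : a ≤ b := by
  by_contra! h
  have h1 := F.val_of_le (le_refl b)
  rw [F.val_of_lt h] at h1
  exact zero_ne_one h1

lemma law_Ioc (F : CDFOn a b) (x y : ℝ) :
    F.law (Set.Ioc x y) = ENNReal.ofReal (F.val y - F.val x) :=
  F.toStieltjesFunction.measure_Ioc x y

lemma tendsto_val_atBot (F : CDFOn a b) : Filter.Tendsto F.val Filter.atBot (nhds 0) := by
  refine tendsto_const_nhds.congr' ?_
  filter_upwards [Filter.eventually_lt_atBot a] with x hx using (F.val_of_lt hx).symm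

lemma law_Iic (F : CDFOn a b) (x : ℝ) : F.law (Set.Iic x) = ENNReal.ofReal (F.val x) := by
  have h := F.toStieltjesFunction.measure_Iic F.tendsto_val_atBot x
  rwa [sub_zero] at h

instance (F : CDFOn a b) : IsProbabilityMeasure F.law := by
  refine F.toStieltjesFunction.isProbabilityMeasure F.tendsto_val_atBot ?_
  refine tendsto_const_nhds.congr' ?_
  filter_upwards [Filter.eventually_ge_atTop b] with x hx using (F.val_of_le hx).symm

/-- There may be an atom at `a`, so the half-open interval has to start further left. -/
lemma ae_mem_Ioc (F : CDFOn a b) : ∀ᵐ x ∂F.law, x ∈ Set.Ioc (a - 1) b := by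
  rw [ae_iff, ← Set.compl_def, prob_compl_eq_zero_iff measurableSet_Ioc, F.law_Ioc,
    F.val_of_le le_rfl, F.val_of_lt (by linarith)]
  simp

/-- The exponential moment `∫ e^{βx} dF(x)`. -/
noncomputable def expMoment (β : ℝ) (F : CDFOn a b) : ℝ := ∫ x, Real.exp (β * x) ∂F.law

lemma integral_mul_exp (β x y : ℝ) :
    ∫ t in x..y, β * Real.exp (β * t) = Real.exp (β * y) - Real.exp (β * x) := by
  refine intervalIntegral.integral_eq_sub_of_hasDerivAt (f := fun t => Real.exp (β * t))
    (fun t _ => ?_) ((by fun_prop : Continuous fun t => β * Real.exp (β * t)).intervalIntegrable _ _)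
  have h := ((hasDerivAt_id t).const_mul β).exp
  simpa [mul_comm] using h

lemma intervalIntegrable_exp_mul_val (β : ℝ) (F : CDFOn a b) (x y : ℝ) :
    IntervalIntegrable (fun t => Real.exp (β * t) * F.val t) volume x y :=
  (F.val_mono.intervalIntegrable).continuousOn_mul
    (by fun_prop : Continuous fun t : ℝ => Real.exp (β * t)).continuousOn

/-- Integration by parts for the exponential moment. -/
lemma expMoment_eq (β : ℝ) (F : CDFOn a b) :
    F.expMoment β = Real.exp (β * b) - β * ∫ x in a..b, Real.exp (β * x) * F.val x := by
  have hab := F.left_le_right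
  have hab' : a - 1 ≤ b := by linarith
  -- Fubini for `1{x ≤ t} β e^{βt}`: integrating over `t` gives `e^{βb} - e^{βx}`, integrating over
  -- `x` gives `β e^{βt} F(t)`.
  set f : ℝ → ℝ → ℝ := fun x t =>
    {p : ℝ × ℝ | p.1 ≤ p.2}.indicator (fun p : ℝ × ℝ => 1 * (β * Real.exp (β * p.2))) (x, t)
    with hf
  have hint : Integrable (Function.uncurry f)
      (F.law.prod (volume.restrict (Set.Ioc (a - 1) b))) := by
    have h1 : Integrable (fun t => β * Real.exp (β * t)) (volume.restrict (Set.Ioc (a - 1) b)) :=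
      ((by fun_prop : Continuous fun t => β * Real.exp (β * t)).integrableOn_Icc).mono_set
        Set.Ioc_subset_Icc_self
    exact ((integrable_const (1 : ℝ)).mul_prod h1).indicator
      (measurableSet_le measurable_fst measurable_snd)
  have hswap := integral_integral_swap hint
  have hL : ∀ᵐ x ∂F.law, ∫ t in Set.Ioc (a - 1) b, f x t =
      Real.exp (β * b) - Real.exp (β * x) := by
    filter_upwards [F.ae_mem_Ioc] with x hx
    have h2 : ∀ t, f x t = (Set.Ici x).indicator (fun t => β * Real.exp (β * t)) t := by
      intro t
      by_cases h : x ≤ t <;> simp [hf, Set.indicator, h]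
    simp only [h2]
    rw [setIntegral_indicator measurableSet_Ici, ← integral_mul_exp,
      intervalIntegral.integral_of_le hx.2, ← integral_Icc_eq_integral_Ioc]
    congr 2
    ext t
    simp only [Set.mem_inter_iff, Set.mem_Ioc, Set.mem_Ici, Set.mem_Icc]
    constructor
    · rintro ⟨⟨-, h⟩, h'⟩; exact ⟨h', h⟩
    · rintro ⟨h, h'⟩; exact ⟨⟨hx.1.trans_le h, h'⟩, h⟩
  have hR : ∀ t, ∫ x, f x t ∂F.law = β * (Real.exp (β * t) * F.val t) := by
    intro t
    have h2 : ∀ x, f x t = (Set.Iic t).indicator (fun _ => β * Real.exp (β * t)) x := by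
      intro x
      by_cases h : x ≤ t <;> simp [hf, Set.indicator, h]
    simp only [h2]
    rw [integral_indicator measurableSet_Iic, setIntegral_const, measureReal_def, F.law_Iic,
      ENNReal.toReal_ofReal (F.val_nonneg t), smul_eq_mul]
    ring
  rw [integral_congr_ae hL] at hswap
  simp only [hR] at hswap
  have hexp : Integrable (fun x => Real.exp (β * x)) F.law := by
    refine Integrable.of_bound (C := Real.exp (β * b) + Real.exp (β * (a - 1)))
      (by fun_prop : Continuous fun x : ℝ => Real.exp (β * x)).aestronglyMeasurable ?_
    filter_upwards [F.ae_mem_Ioc] with x hx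
    rw [Real.norm_of_nonneg (Real.exp_pos _).le]
    rcases le_total 0 β with h | h
    · have : Real.exp (β * x) ≤ Real.exp (β * b) :=
        Real.exp_le_exp.2 (mul_le_mul_of_nonneg_left hx.2 h)
      linarith [Real.exp_pos (β * (a - 1))]
    · have : Real.exp (β * x) ≤ Real.exp (β * (a - 1)) :=
        Real.exp_le_exp.2 (mul_le_mul_of_nonpos_left hx.1.le h)
      linarith [Real.exp_pos (β * b)]
  rw [integral_sub (integrable_const _) hexp, integral_const, integral_const_mul,
    ← intervalIntegral.integral_of_le hab',
    ← intervalIntegral.integral_add_adjacent_intervals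
      (F.intervalIntegrable_exp_mul_val β (a - 1) a) (F.intervalIntegrable_exp_mul_val β a b)]
    at hswap
  have h0 : ∫ t in (a - 1)..a, Real.exp (β * t) * F.val t = 0 := by
    rw [intervalIntegral.integral_of_le (by linarith), integral_Ioc_eq_integral_Ioo]
    refine (setIntegral_congr_fun measurableSet_Ioo fun t ht => ?_).trans (integral_zero _ _)
    simp [F.val_of_lt ht.2]
  rw [h0, zero_add] at hswap
  simp only [probReal_univ, one_smul] at hswap
  rw [expMoment]
  linarith

/-- After integration by parts, `1/β` cancels the factor `β` of the integral, so the direction does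
not depend on the sign of `β`. -/
lemma expMoment_le_of_val_le {β : ℝ} {F G : CDFOn a b} (h : ∀ x, F.val x ≤ G.val x) :
    1 / β * G.expMoment β ≤ 1 / β * F.expMoment β := by
  rcases eq_or_ne β 0 with rfl | hβ
  · simp
  have hi : ∫ x in a..b, Real.exp (β * x) * F.val x ≤ ∫ x in a..b, Real.exp (β * x) * G.val x :=
    intervalIntegral.integral_mono_on F.left_le_right (F.intervalIntegrable_exp_mul_val β a b)
      (G.intervalIntegrable_exp_mul_val β a b)
      fun x _ => mul_le_mul_of_nonneg_left (h x) (Real.exp_pos _).le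
  rw [expMoment_eq, expMoment_eq, mul_sub, mul_sub, ← mul_assoc, ← mul_assoc,
    one_div_mul_cancel hβ]
  linarith

lemma abs_expMoment_sub_le {β d : ℝ} {F G : CDFOn a b} (h : ∀ x, |F.val x - G.val x| ≤ d) :
    |F.expMoment β - G.expMoment β| ≤ |Real.exp (β * b) - Real.exp (β * a)| * d := by
  have hab := F.left_le_right
  have hpos : ∀ x ∈ Set.Icc a b, 0 ≤ Real.exp (β * x) := fun x _ => (Real.exp_pos _).le
  have h1 : F.expMoment β - G.expMoment β =
      -(β * ∫ x in a..b, Real.exp (β * x) * (F.val x - G.val x)) := by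
    rw [expMoment_eq, expMoment_eq]
    simp only [mul_sub]
    rw [intervalIntegral.integral_sub (F.intervalIntegrable_exp_mul_val β a b)
      (G.intervalIntegrable_exp_mul_val β a b)]
    ring
  have h2 : |∫ x in a..b, Real.exp (β * x) * (F.val x - G.val x)| ≤
      (∫ x in a..b, Real.exp (β * x)) * d := by
    rw [← intervalIntegral.integral_mul_const]
    refine (intervalIntegral.abs_integral_le_integral_abs hab).trans ?_
    refine intervalIntegral.integral_mono_on hab ?_ ?_ fun x _ => ?_
    · simp only [mul_sub]
      exact ((F.intervalIntegrable_exp_mul_val β a b).sub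
        (G.intervalIntegrable_exp_mul_val β a b)).abs
    · exact (by fun_prop : Continuous fun x => Real.exp (β * x) * d).intervalIntegrable _ _
    · rw [abs_mul, abs_of_pos (Real.exp_pos _)]
      exact mul_le_mul_of_nonneg_left (h x) (Real.exp_pos _).le
  have h3 : 0 ≤ ∫ x in a..b, Real.exp (β * x) := intervalIntegral.integral_nonneg hab hpos
  rw [h1, abs_neg, abs_mul, ← integral_mul_exp, intervalIntegral.integral_const_mul, abs_mul,
    abs_of_nonneg h3, mul_assoc]
  exact mul_le_mul_of_nonneg_left h2 (abs_nonneg _)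

/-- Keeps the moment away from zero, where the logarithm is steep; it is `0 ≤ F ≤ 1` inserted in the
integration by parts. -/
lemma min_exp_le_expMoment (β : ℝ) (F : CDFOn a b) :
    min (Real.exp (β * a)) (Real.exp (β * b)) ≤ F.expMoment β := by
  have hab := F.left_le_right
  have h1 : ∫ x in a..b, Real.exp (β * x) * F.val x ≤ ∫ x in a..b, Real.exp (β * x) :=
    intervalIntegral.integral_mono_on hab (F.intervalIntegrable_exp_mul_val β a b)
      ((by fun_prop : Continuous fun x => Real.exp (β * x)).intervalIntegrable _ _)
      fun x _ => mul_le_of_le_one_right (Real.exp_pos _).le (F.val_le_one x)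
  have h2 : 0 ≤ ∫ x in a..b, Real.exp (β * x) * F.val x :=
    intervalIntegral.integral_nonneg hab
      fun x _ => mul_nonneg (Real.exp_pos _).le (F.val_nonneg x)
  have h3 := integral_mul_exp β a b
  rw [intervalIntegral.integral_const_mul] at h3
  rw [expMoment_eq]
  rcases le_total 0 β with h | h
  · refine (min_le_left _ _).trans ?_
    nlinarith [mul_le_mul_of_nonneg_left h1 h]
  · refine (min_le_right _ _).trans ?_
    nlinarith [mul_nonneg_of_nonpos_of_nonpos h (neg_nonpos.2 h2)]

lemma expMoment_pos (β : ℝ) (F : CDFOn a b) : 0 < F.expMoment β :=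
  (lt_min (Real.exp_pos _) (Real.exp_pos _)).trans_le (F.min_exp_le_expMoment β)

lemma entRM_law (β : ℝ) (F : CDFOn a b) : entRM β F.law = 1 / β * Real.log (F.expMoment β) := rfl

/-- Removes the logarithm: the right-hand side is affine in the distribution, which suits Bellman
recursions. For `β < 0` both the prefactor and the comparison of logarithms reverse. -/
lemma entRM_law_le_iff {a' b' β : ℝ} (F : CDFOn a b) (G : CDFOn a' b') :
    entRM β F.law ≤ entRM β G.law ↔ 1 / β * F.expMoment β ≤ 1 / β * G.expMoment β := by
  rw [entRM_law, entRM_law]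
  rcases lt_trichotomy β 0 with h | rfl | h
  · rw [mul_le_mul_left_of_neg (one_div_neg.2 h), mul_le_mul_left_of_neg (one_div_neg.2 h),
      Real.log_le_log_iff (G.expMoment_pos β) (F.expMoment_pos β)]
  · simp
  · rw [mul_le_mul_iff_right₀ (one_div_pos.2 h), mul_le_mul_iff_right₀ (one_div_pos.2 h),
      Real.log_le_log_iff (F.expMoment_pos β) (G.expMoment_pos β)]

lemma expMoment_widen {a' b' : ℝ} (ha : a' ≤ a) (hb : b ≤ b') (β : ℝ) (F : CDFOn a b) :
    (F.widen ha hb).expMoment β = F.expMoment β := rfl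

lemma expMoment_shift (β c : ℝ) (F : CDFOn a b) :
    (F.shift c).expMoment β = Real.exp (β * c) * F.expMoment β := by
  have h : ∫ x in (c + a)..(c + b), Real.exp (β * x) * (F.shift c).val x =
      Real.exp (β * c) * ∫ x in a..b, Real.exp (β * x) * F.val x := by
    rw [← intervalIntegral.integral_const_mul]
    have h1 := intervalIntegral.integral_comp_add_left (a := a) (b := b)
      (fun x => Real.exp (β * x) * (F.shift c).val x) c
    rw [← h1]
    refine intervalIntegral.integral_congr fun x _ => ?_
    have h2 : (F.shift c).val (c + x) = F.val x := by
      change F.val (c + x - c) = F.val x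
      rw [add_sub_cancel_left]
    simp only [h2]
    rw [mul_add, Real.exp_add, mul_assoc]
  rw [expMoment_eq, expMoment_eq, h, mul_add, Real.exp_add]
  ring

lemma expMoment_mix {S : Type*} [Fintype S] (β : ℝ) (p : PMF S) (ν : S → CDFOn a b) :
    (mix p ν).expMoment β = ∑ s, (p s).toReal * (ν s).expMoment β := by
  have h : ∫ x in a..b, Real.exp (β * x) * (mix p ν).val x =
      ∑ s, (p s).toReal * ∫ x in a..b, Real.exp (β * x) * (ν s).val x := by
    simp only [← intervalIntegral.integral_const_mul]
    rw [← intervalIntegral.integral_finsetSum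
      fun s _ => ((ν s).intervalIntegrable_exp_mul_val β a b).const_mul _]
    refine intervalIntegral.integral_congr fun x _ => ?_
    change Real.exp (β * x) * ∑ s, (p s).toReal * (ν s).val x = _
    rw [Finset.mul_sum]
    exact Finset.sum_congr rfl fun s _ => mul_left_comm _ _ _
  simp only [expMoment_eq, h, mul_sub, Finset.sum_sub_distrib]
  rw [← Finset.sum_mul, p.sum_toReal, one_mul, Finset.mul_sum]
  congr 1
  exact Finset.sum_congr rfl fun s _ => mul_left_comm _ _ _

lemma expMoment_diracRight (β : ℝ) (hab : a ≤ b) :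
    (diracRight a b hab).expMoment β = Real.exp (β * b) := by
  have h : ∫ x in a..b, Real.exp (β * x) * (diracRight a b hab).val x = 0 := by
    rw [intervalIntegral.integral_of_le hab, integral_Ioc_eq_integral_Ioo]
    refine (setIntegral_congr_fun measurableSet_Ioo fun t ht => ?_).trans (integral_zero _ _)
    simp [diracRight, val, ht.2]
  rw [expMoment_eq, h, mul_zero, sub_zero]

lemma bddAbove_abs_val_sub (F G : CDFOn a b) :
    BddAbove (Set.range fun x => |F.val x - G.val x|) := by
  refine ⟨1, ?_⟩
  rintro _ ⟨x, rfl⟩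
  exact abs_sub_le_of_nonneg_of_le (F.val_nonneg x) (F.val_le_one x) (G.val_nonneg x)
    (G.val_le_one x)

lemma abs_val_sub_le_supDist (F G : CDFOn a b) (x : ℝ) : |F.val x - G.val x| ≤ F.supDist G :=
  le_ciSup (F.bddAbove_abs_val_sub G) x

end CDFOn

/-! ### The Lipschitz constant of the entropic risk measure. -/

lemma lipConst_nonneg (β : ℝ) (H : ℕ) : 0 ≤ lipConst β H :=
  div_nonneg (sub_nonneg.2 (Real.one_le_exp (by positivity))) (abs_nonneg _)

lemma abs_log_sub_log_le {m x y : ℝ} (hm : 0 < m) (hx : m ≤ x) (hy : m ≤ y) :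
    |Real.log x - Real.log y| ≤ |x - y| / m := by
  have key : ∀ u v : ℝ, m ≤ u → m ≤ v → Real.log u - Real.log v ≤ |u - v| / m := by
    intro u v hu hv
    have hv0 := hm.trans_le hv
    rw [← Real.log_div (hm.trans_le hu).ne' hv0.ne']
    have h1 := Real.log_le_sub_one_of_pos (div_pos (hm.trans_le hu) hv0)
    have h2 : u / v - 1 = (u - v) / v := by field_simp
    rw [h2] at h1
    refine h1.trans ((div_le_div_of_nonneg_right (le_abs_self _) hv0.le).trans ?_)
    exact div_le_div_of_nonneg_left (abs_nonneg _) hm hv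
  rw [abs_le]
  constructor
  · have := key y x hy hx
    rw [abs_sub_comm] at this
    linarith
  · exact key x y hx hy

/-- The entropic risk measure is Lipschitz on the distributions supported on `[0, H]`. -/
lemma abs_entRM_sub_le {β : ℝ} (hβ : β ≠ 0) {H : ℕ} {F G : CDFOn 0 (H : ℝ)} {d : ℝ}
    (h : ∀ x, |F.val x - G.val x| ≤ d) :
    |entRM β F.law - entRM β G.law| ≤ lipConst β H * d := by
  have hd : 0 ≤ d := (abs_nonneg _).trans (h 0)
  have h1 := CDFOn.abs_expMoment_sub_le (β := β) h
  have hm : 0 < min (Real.exp (β * 0)) (Real.exp (β * H)) :=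
    lt_min (Real.exp_pos _) (Real.exp_pos _)
  have h2 := abs_log_sub_log_le hm (F.min_exp_le_expMoment β) (G.min_exp_le_expMoment β)
  rw [CDFOn.entRM_law, CDFOn.entRM_law, ← mul_sub, abs_mul, abs_div, abs_one, lipConst,
    div_mul_eq_mul_div, div_mul_eq_mul_div, one_mul]
  refine div_le_div_of_nonneg_right (h2.trans ?_) (abs_nonneg _)
  rw [div_le_iff₀ hm]
  refine h1.trans ?_
  rw [mul_right_comm]
  refine mul_le_mul_of_nonneg_right (le_of_eq ?_) hd
  rw [mul_zero, Real.exp_zero]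
  have hH : (0 : ℝ) ≤ H := Nat.cast_nonneg H
  -- For either sign, `|e^{βH} - 1| = (e^{|β|H} - 1) · min 1 e^{βH}`.
  rcases lt_or_gt_of_ne hβ with h | h
  · have h3 : Real.exp (β * H) ≤ 1 := Real.exp_le_one_iff.2 (mul_nonpos_of_nonpos_of_nonneg h.le hH)
    have h4 : Real.exp (-(β * H)) * Real.exp (β * H) = 1 := by
      rw [← Real.exp_add, neg_add_cancel, Real.exp_zero]
    rw [min_eq_right h3, abs_of_nonpos (by linarith), abs_of_neg h, neg_mul, sub_mul, h4]
    ring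
  · have h3 : 1 ≤ Real.exp (β * H) := Real.one_le_exp (by positivity)
    rw [min_eq_left h3, abs_of_nonneg (by linarith), abs_of_pos h, mul_one]

/-- Two-point mixtures show that the Lipschitz constant cannot be improved. -/
lemma lipConst_le_of_forall_abs_entRM_sub_le {β : ℝ} (hβ : β ≠ 0) {H : ℕ} {L : ℝ} (hL : 0 ≤ L)
    (h : ∀ F G : CDFOn 0 (H : ℝ), |entRM β F.law - entRM β G.law| ≤ L * F.supDist G) :
    lipConst β H ≤ L := by
  have hH : (0 : ℝ) ≤ H := Nat.cast_nonneg H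
  set M := Real.exp (|β| * H) - 1 with hM
  have hM0 : 0 ≤ M := sub_nonneg.2 (Real.one_le_exp (by positivity))
  have hβ' : 0 < |β| := abs_pos.2 hβ
  -- `F₀` and `F₁` are the Dirac masses at the endpoints, ordered so that `F₀` has the smaller
  -- moment; the ratio of the moments is `1 + M = e^{|β|H}`.
  obtain ⟨F₀, F₁, x, hx, h0, h1⟩ : ∃ (F₀ F₁ : CDFOn 0 (H : ℝ)) (x : ℝ), 0 < x ∧
      F₀.expMoment β = x ∧ F₁.expMoment β = x * (1 + M) := by
    have e0 : ((CDFOn.diracRight 0 0 le_rfl).widen le_rfl hH).expMoment β = 1 := by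
      rw [CDFOn.expMoment_widen, CDFOn.expMoment_diracRight, mul_zero, Real.exp_zero]
    rcases lt_or_gt_of_ne hβ with hb | hb
    · refine ⟨CDFOn.diracRight 0 H hH, (CDFOn.diracRight 0 0 le_rfl).widen le_rfl hH,
        Real.exp (β * H), Real.exp_pos _, CDFOn.expMoment_diracRight β hH, ?_⟩
      rw [e0, hM, abs_of_neg hb, add_sub_cancel, ← Real.exp_add]
      simp
    · refine ⟨(CDFOn.diracRight 0 0 le_rfl).widen le_rfl hH, CDFOn.diracRight 0 H hH, 1,
        one_pos, e0, ?_⟩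
      rw [CDFOn.expMoment_diracRight, hM, abs_of_pos hb]
      ring
  -- The mixture with weight `t` on `F₁` is within `t` of `F₀` and has moment `x (1 + tM)`. Then
  -- `log (1 + tM) ≥ tM / (1 + tM)`, and `t` cancels; letting `t → 0` below gives the bound.
  have key : ∀ t ∈ Set.Ioc (0 : ℝ) 1, M ≤ |β| * L * (1 + t * M) := by
    intro t ht
    obtain ⟨p, hpt⟩ : ∃ p : PMF Bool, (p true).toReal = t := by
      refine ⟨PMF.ofFintype (fun i => if i then ENNReal.ofReal t else ENNReal.ofReal (1 - t)) ?_,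
        ?_⟩
      · rw [Fintype.sum_bool, if_pos rfl, if_neg Bool.false_ne_true,
          ← ENNReal.ofReal_add ht.1.le (sub_nonneg.2 ht.2), add_sub_cancel, ENNReal.ofReal_one]
      · rw [PMF.ofFintype_apply, if_pos rfl, ENNReal.toReal_ofReal ht.1.le]
    have hpf : (p false).toReal = 1 - t := by
      have := p.sum_toReal
      simp only [Fintype.sum_bool, hpt] at this
      linarith
    set G := CDFOn.mix p fun i => if i then F₁ else F₀ with hG
    have hGm : G.expMoment β = x * (1 + t * M) := by
      rw [hG, CDFOn.expMoment_mix]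
      simp only [Fintype.sum_bool, hpt, hpf, if_true, Bool.false_eq_true, if_false, h0, h1]
      ring
    have hd : G.supDist F₀ ≤ t := by
      refine ciSup_le fun y => ?_
      have hv : G.val y = t * F₁.val y + (1 - t) * F₀.val y := by
        change ∑ i, (p i).toReal * CDFOn.val (if i then F₁ else F₀) y = _
        simp only [Fintype.sum_bool, hpt, hpf, if_true, Bool.false_eq_true, if_false]
      have : G.val y - F₀.val y = t * (F₁.val y - F₀.val y) := by rw [hv]; ring
      rw [this, abs_mul, abs_of_pos ht.1]
      exact mul_le_of_le_one_right ht.1.le (abs_sub_le_of_nonneg_of_le (F₁.val_nonneg y)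
        (F₁.val_le_one y) (F₀.val_nonneg y) (F₀.val_le_one y))
    have htM : 0 < 1 + t * M := by
      have := mul_nonneg ht.1.le hM0
      linarith
    have hle := (h G F₀).trans (mul_le_mul_of_nonneg_left hd hL)
    rw [CDFOn.entRM_law, CDFOn.entRM_law, hGm, h0, Real.log_mul hx.ne' htM.ne', ← mul_sub,
      add_sub_cancel_left, abs_mul, abs_div, abs_one, one_div, inv_mul_le_iff₀ hβ'] at hle
    have hlog := Real.one_sub_inv_le_log_of_pos htM
    have h5 : 1 - (1 + t * M)⁻¹ = t * M / (1 + t * M) := by field_simp; ring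
    have h6 := (h5 ▸ hlog).trans ((le_abs_self _).trans hle)
    rw [div_le_iff₀ htM] at h6
    refine le_of_mul_le_mul_left ?_ ht.1
    linarith
  rw [lipConst, div_le_iff₀ hβ', mul_comm L]
  have hlim : Filter.Tendsto (fun t : ℝ => |β| * L * (1 + t * M)) (nhdsWithin 0 (Set.Ioi 0))
      (nhds (|β| * L)) := by
    have : Continuous fun t : ℝ => |β| * L * (1 + t * M) := by fun_prop
    have := (this.tendsto 0).mono_left (nhdsWithin_le_nhds (s := Set.Ioi 0))
    simpa using this
  refine ge_of_tendsto hlim ?_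
  filter_upwards [Ioc_mem_nhdsGT (zero_lt_one (α := ℝ))] with t ht using key t ht

lemma isLeast_lipConst {β : ℝ} (hβ : β ≠ 0) (H : ℕ) :
    IsLeast {L : ℝ | 0 ≤ L ∧ ∀ F G : CDFOn 0 (H : ℝ),
      |entRM β F.law - entRM β G.law| ≤ L * F.supDist G} (lipConst β H) :=
  ⟨⟨lipConst_nonneg β H, fun F G => abs_entRM_sub_le hβ (F.abs_val_sub_le_supDist G)⟩,
    fun _ hL => lipConst_le_of_forall_abs_entRM_sub_le hβ hL.1 hL.2⟩

/-! ### Bellman recursion for return distributions, and optimism. -/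

section Returns

variable {S A : Type*} {H : ℕ}

namespace EpisodicMDP

/-- The distributional Bellman backup of the return distributions `ν` of the next step. -/
noncomputable def returnBackup [Fintype S] (M : EpisodicMDP S A H) (n : ℕ) (hn : n < H)
    (ν : S → CDFOn 0 (n : ℝ)) (s : S) (a : A) : CDFOn 0 ((n + 1 : ℕ) : ℝ) :=
  ((CDFOn.mix (M.P (Fin.rev ⟨n, hn⟩) s a) ν).shift (M.r (Fin.rev ⟨n, hn⟩) s a)).widen
    (by simpa using M.r_nonneg _ s a)
    (by push_cast; linarith [M.r_le_one (Fin.rev ⟨n, hn⟩) s a])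

/-- The law of the return over the last `n` steps, under the policy `π`. -/
noncomputable def returnDist [Fintype S] (M : EpisodicMDP S A H) (π : Policy S A H) :
    (n : ℕ) → n ≤ H → S → CDFOn 0 (n : ℝ)
  | 0, _ => fun _ => CDFOn.diracRight 0 ((0 : ℕ) : ℝ) (Nat.cast_nonneg _)
  | n + 1, hn => fun s =>
      M.returnBackup n hn (M.returnDist π n (Nat.le_of_succ_le hn)) s (π (Fin.rev ⟨n, hn⟩) s)

lemma expMoment_returnBackup [Fintype S] (M : EpisodicMDP S A H) (β : ℝ) (n : ℕ) (hn : n < H)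
    (ν : S → CDFOn 0 (n : ℝ)) (s : S) (a : A) :
    (M.returnBackup n hn ν s a).expMoment β = Real.exp (β * M.r (Fin.rev ⟨n, hn⟩) s a) *
      ∑ s', (M.P (Fin.rev ⟨n, hn⟩) s a s').toReal * (ν s').expMoment β := by
  rw [returnBackup, CDFOn.expMoment_widen, CDFOn.expMoment_shift, CDFOn.expMoment_mix]

/-- The moment of a backup is a nonnegative combination of the next moments, so it preserves the
order, with `1/β` carrying the sign. -/
lemma expMoment_returnBackup_mono [Fintype S] (M : EpisodicMDP S A H) {β : ℝ} (n : ℕ)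
    (hn : n < H) {ν ν' : S → CDFOn 0 (n : ℝ)} (s : S) (a : A)
    (h : ∀ s', 1 / β * (ν s').expMoment β ≤ 1 / β * (ν' s').expMoment β) :
    1 / β * (M.returnBackup n hn ν s a).expMoment β ≤
      1 / β * (M.returnBackup n hn ν' s a).expMoment β := by
  rw [expMoment_returnBackup, expMoment_returnBackup, mul_left_comm, mul_left_comm (1 / β)]
  refine mul_le_mul_of_nonneg_left ?_ (Real.exp_pos _).le
  rw [Finset.mul_sum, Finset.mul_sum]
  refine Finset.sum_le_sum fun s' _ => ?_
  rw [mul_left_comm, mul_left_comm (1 / β)]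
  exact mul_le_mul_of_nonneg_left (h s') ENNReal.toReal_nonneg

lemma lexp_episodeLaw_exp_totalReward [Fintype S] (M : EpisodicMDP S A H) (β : ℝ)
    (π : Policy S A H) (s₁ : S) :
    ((M.statesLaw π s₁ H le_rfl).lexp fun x =>
      ENNReal.ofReal (Real.exp (β * M.totalReward ⟨x, fun h => π h (x h.castSucc)⟩))) =
    ENNReal.ofReal ((M.returnDist π H le_rfl s₁).expMoment β) := by
  have h := M.lexp_statesLaw_prod π s₁ (fun _ => 1)
    (fun h s _ => ENNReal.ofReal (Real.exp (β * M.r h s (π h s))))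
    (fun n hn s => ENNReal.ofReal ((M.returnDist π n hn s).expMoment β)) ?_ H le_rfl 0
    (Nat.zero_le _) rfl
  · simp only [one_mul] at h
    rw [← h]
    congr 1
    funext x
    have h0 : (M.returnDist π 0 (Nat.zero_le H) (x (Fin.last H))).expMoment β = 1 := by
      rw [returnDist, CDFOn.expMoment_diracRight]
      simp
    rw [h0, ENNReal.ofReal_one, mul_one, totalReward, Finset.mul_sum, Real.exp_sum,
      ENNReal.ofReal_prod_of_nonneg fun _ _ => (Real.exp_pos _).le]
    rfl
  · intro n hn s
    rw [PMF.lexp_const_mul, PMF.lexp_ofReal _ fun s' => (CDFOn.expMoment_pos β _).le,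
      ← ENNReal.ofReal_mul (Real.exp_pos _).le, returnDist, expMoment_returnBackup]

/-- Only exponential moments have to agree: `e^{β · return}` is a product over the steps, so exact
backward induction computes its mean. -/
lemma value_eq_entRM_returnDist [Fintype S] (M : EpisodicMDP S A H) (β : ℝ) (π : Policy S A H)
    (s₁ : S) : M.value β π s₁ = entRM β (M.returnDist π H le_rfl s₁).law := by
  rw [value, CDFOn.entRM_law, entRM]
  congr 2
  let _ : MeasurableSpace (Fin (H + 1) → S) := ⊤
  have : MeasurableSingletonClass (Fin (H + 1) → S) := ⟨fun _ => trivial⟩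
  have hm : ∀ f : (Fin (H + 1) → S) → ℝ, Measurable f := fun f => measurable_of_finite f
  rw [episodeLaw, PMF.map_comp, ← PMF.toMeasure_map _ _ (hm _),
    MeasureTheory.integral_map (hm _).aemeasurable
      (by fun_prop : Continuous fun x : ℝ => Real.exp (β * x)).aestronglyMeasurable,
    PMF.integral_eq_sum]
  have h := M.lexp_episodeLaw_exp_totalReward β π s₁
  rw [PMF.lexp_ofReal _ fun x => (Real.exp_pos _).le,
    ENNReal.ofReal_eq_ofReal_iff
      (Finset.sum_nonneg fun x _ => mul_nonneg ENNReal.toReal_nonneg (Real.exp_pos _).le)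
      (CDFOn.expMoment_pos β _).le] at h
  exact h

end EpisodicMDP

/-- The worst set is `{q ≤ p}`, which gives the upper side. Since both masses are one, the lower
side is the upper side for `1 - v`. -/
lemma PMF.abs_sum_sub_sum_le [Fintype S] {p q : PMF S} {c : ℝ}
    (h : ∀ B : Finset S, ∑ s ∈ B, (p s).toReal - ∑ s ∈ B, (q s).toReal ≤ c) {v : S → ℝ}
    (hv : ∀ s, 0 ≤ v s) (hv' : ∀ s, v s ≤ 1) :
    |∑ s, (p s).toReal * v s - ∑ s, (q s).toReal * v s| ≤ c := by
  classical
  have key : ∀ w : S → ℝ, (∀ s, 0 ≤ w s) → (∀ s, w s ≤ 1) →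
      ∑ s, (p s).toReal * w s - ∑ s, (q s).toReal * w s ≤ c := by
    intro w hw hw'
    refine le_trans ?_ (h {s | (q s).toReal ≤ (p s).toReal})
    rw [← Finset.sum_sub_distrib, ← Finset.sum_sub_distrib, Finset.sum_filter]
    refine Finset.sum_le_sum fun s _ => ?_
    split_ifs with hs
    · nlinarith [hw s, hw' s]
    · nlinarith [hw s, hw' s]
  have h1 := key v hv hv'
  have h2 := key (fun s => 1 - v s) (fun s => sub_nonneg.2 (hv' s))
    fun s => by linarith [hv s]
  simp only [mul_sub, mul_one, Finset.sum_sub_distrib, PMF.sum_toReal] at h2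
  rw [abs_le]
  constructor <;> linarith

open Classical in
/-- The number of visits of `(s, a)` at step `h` that were followed by a state in `B`. -/
noncomputable def hitCount (hist : History S A H) (h : Fin H) (s : S) (a : A) (B : Finset S) : ℕ :=
  ∑ s' ∈ B, (nextStates hist h s a).count s'

/-- The empirical transition probabilities are within the bonus of the true ones, in total
variation. -/
def IsAccurate [Fintype S] (M : EpisodicMDP S A H) (iota : ℝ) (hist : History S A H) : Prop :=
  ∀ (h : Fin H) (s : S) (a : A), 0 < visitCount hist h s a → ∀ B : Finset S,
    (hitCount hist h s a B : ℝ) -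
      visitCount hist h s a * ∑ s' ∈ B, (M.P h s a s').toReal ≤
      visitCount hist h s a * bonus iota hist h s a

variable [Fintype S]

/-- The bound is uniform in `v`. This matters because the planned distributions put in place of `v`
depend on the same data as the empirical transitions. -/
lemma IsAccurate.abs_sum_sub_sum_le {M : EpisodicMDP S A H} {iota : ℝ} {hist : History S A H}
    (hacc : IsAccurate M iota hist) {h : Fin H} {s : S} {a : A}
    (hN : 0 < visitCount hist h s a) {v : S → ℝ} (hv : ∀ s, 0 ≤ v s) (hv' : ∀ s, v s ≤ 1) :
    |∑ s', (PMF.ofMultiset _ (nextStates_ne_zero hN) s').toReal * v s' -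
      ∑ s', (M.P h s a s').toReal * v s'| ≤ bonus iota hist h s a := by
  refine PMF.abs_sum_sub_sum_le (fun B => ?_) hv hv'
  have hN' : (0 : ℝ) < visitCount hist h s a := Nat.cast_pos.2 hN
  have hcard : Multiset.card (nextStates hist h s a) = visitCount hist h s a := by
    simp [nextStates, visitCount]
  have h1 : ∑ s' ∈ B, (PMF.ofMultiset _ (nextStates_ne_zero hN) s').toReal =
      hitCount hist h s a B / visitCount hist h s a := by
    simp only [PMF.ofMultiset_apply, hcard, ENNReal.toReal_div, ENNReal.toReal_natCast]
    rw [← Finset.sum_div, hitCount, Nat.cast_sum]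
  rw [h1, div_sub' hN'.ne', div_le_iff₀ hN', mul_comm (bonus _ _ _ _ _)]
  exact hacc h s a hN B

lemma optimisticBackup_val_of_pos (M : EpisodicMDP S A H) (W : SupportWindow M) (iota : ℝ)
    (hist : History S A H) (n : ℕ) (hn : n < H) (ν : S → CDFOn 0 (n : ℝ)) (s : S) (a : A)
    (hN : 0 < visitCount hist (Fin.rev ⟨n, hn⟩) s a) (x : ℝ) :
    (optimisticBackup M W iota hist n hn ν s a).val x =
      max ((∑ s', (PMF.ofMultiset _ (nextStates_ne_zero hN) s').toReal *
          (ν s').val (x - M.r (Fin.rev ⟨n, hn⟩) s a)) -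
        bonus iota hist (Fin.rev ⟨n, hn⟩) s a *
          (Set.Ico (W.lo (Fin.rev ⟨n, hn⟩) s a) (W.hi (Fin.rev ⟨n, hn⟩) s a)).indicator
            (fun _ => (1 : ℝ)) x) 0 := by
  simp only [optimisticBackup]
  rw [dif_pos hN]
  rfl

lemma optimisticBackup_val_of_eq_zero (M : EpisodicMDP S A H) (W : SupportWindow M) (iota : ℝ)
    (hist : History S A H) (n : ℕ) (hn : n < H) (ν : S → CDFOn 0 (n : ℝ)) (s : S) (a : A)
    (hN : ¬ 0 < visitCount hist (Fin.rev ⟨n, hn⟩) s a) {x : ℝ} (hx : x < (n + 1 : ℕ)) :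
    (optimisticBackup M W iota hist n hn ν s a).val x = 0 := by
  simp only [optimisticBackup]
  rw [dif_neg hN]
  change max ((if ((n + 1 : ℕ) : ℝ) ≤ x then (1 : ℝ) else 0) - _ * _) 0 = 0
  rw [if_neg (not_le.2 hx), zero_sub]
  exact max_eq_right (neg_nonpos.2 (mul_nonneg (bonus_nonneg _ _ _ _ _)
    (Set.indicator_nonneg (fun _ _ => zero_le_one) x)))

lemma returnBackup_val (M : EpisodicMDP S A H) (n : ℕ) (hn : n < H)
    (ν : S → CDFOn 0 (n : ℝ)) (s : S) (a : A) (x : ℝ) :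
    (M.returnBackup n hn ν s a).val x = ∑ s', (M.P (Fin.rev ⟨n, hn⟩) s a s').toReal *
      (ν s').val (x - M.r (Fin.rev ⟨n, hn⟩) s a) := rfl

/-- On accurate histories, the optimistic backup dominates the Bellman backup. -/
lemma IsAccurate.optimisticBackup_val_le {M : EpisodicMDP S A H} {iota : ℝ}
    {hist : History S A H} (hacc : IsAccurate M iota hist) (W : SupportWindow M) (n : ℕ)
    (hn : n < H) (ν : S → CDFOn 0 (n : ℝ)) (s : S) (a : A) (x : ℝ) :
    (optimisticBackup M W iota hist n hn ν s a).val x ≤ (M.returnBackup n hn ν s a).val x := by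
  set h : Fin H := Fin.rev ⟨n, hn⟩ with hh
  by_cases hN : 0 < visitCount hist h s a
  · rw [optimisticBackup_val_of_pos M W iota hist n hn ν s a hN]
    refine max_le ?_ ((M.returnBackup n hn ν s a).val_nonneg x)
    by_cases hx : x ∈ Set.Ico (W.lo h s a) (W.hi h s a)
    · rw [Set.indicator_of_mem hx, mul_one, returnBackup_val]
      have := (abs_le.1 (hacc.abs_sum_sub_sum_le hN
        (fun s' => (ν s').val_nonneg (x - M.r h s a)) fun s' => (ν s').val_le_one _)).2
      linarith
    · rw [Set.indicator_of_notMem hx, mul_zero, sub_zero, returnBackup_val]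
      -- The window contains the support `[r, r + n]` of the backups, so outside it no correction is
      -- needed: both CDFs are `0` on its left and `1` on its right.
      rcases lt_or_ge x (W.lo h s a) with hx' | hx'
      · have h0 : ∀ s', (ν s').val (x - M.r h s a) = 0 := fun s' =>
          (ν s').val_of_lt (by linarith [W.lo_le h s a])
        simp [← hh, h0]
      · have hhi : W.hi h s a ≤ x := by
          by_contra! hc
          exact hx ⟨hx', hc⟩
        have h1 : ∀ s', (ν s').val (x - M.r h s a) = 1 := fun s' => by
          refine (ν s').val_of_le ?_
          have := W.le_hi h s a
          rw [hh, Fin.rev_rev] at this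
          have h2 : ((⟨n, hn⟩ : Fin H) : ℕ) = n := rfl
          rw [h2] at this
          linarith
        simp only [← hh, h1, mul_one, PMF.sum_toReal, le_refl]
  · rcases lt_or_ge x ((n + 1 : ℕ) : ℝ) with hx | hx
    · rw [optimisticBackup_val_of_eq_zero M W iota hist n hn ν s a hN hx]
      exact CDFOn.val_nonneg _ _
    · rw [CDFOn.val_of_le _ hx, CDFOn.val_of_le _ hx]

/-- Optimism of the planned return distributions. -/
lemma IsAccurate.expMoment_returnDist_le {M : EpisodicMDP S A H} {β iota : ℝ}
    {hist : History S A H} (hacc : IsAccurate M iota hist) {W : SupportWindow M}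
    {π : Policy S A H} (hπ : IsPlannedPolicy M W β iota hist π) (π' : Policy S A H) :
    ∀ (n : ℕ) (hn : n ≤ H) (s : S), 1 / β * (M.returnDist π' n hn s).expMoment β ≤
      1 / β * (plannedReturn M W iota hist π n hn s).expMoment β
  | 0, _, _ => le_rfl
  | n + 1, hn, s => by
    have ih := hacc.expMoment_returnDist_le hπ π' n (Nat.le_of_succ_le hn)
    -- Three comparisons: the induction hypothesis through the true backup, the domination of the
    -- optimistic backup at the action of `π'`, and the greedy choice of `π`.
    refine (M.expMoment_returnBackup_mono n hn s (π' (Fin.rev ⟨n, hn⟩) s) ih).trans ?_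
    refine (CDFOn.expMoment_le_of_val_le
      (hacc.optimisticBackup_val_le W n hn _ s (π' (Fin.rev ⟨n, hn⟩) s))).trans ?_
    exact (CDFOn.entRM_law_le_iff _ _).1 (hπ n hn s (π' (Fin.rev ⟨n, hn⟩) s))

/-! ### Distance between planned and true return distributions. -/

/-- Upper bound for the distance between the planned and the true return distributions: the
expected sum of the bonuses along an episode, truncated at `1`. -/
noncomputable def planningGap (M : EpisodicMDP S A H) (iota : ℝ) (hist : History S A H)
    (π : Policy S A H) : (n : ℕ) → n ≤ H → S → ℝ
  | 0, _ => fun _ => 0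
  | n + 1, hn => fun s =>
      min 1 (2 * bonus iota hist (Fin.rev ⟨n, hn⟩) s (π (Fin.rev ⟨n, hn⟩) s) +
        ∑ s', (M.P (Fin.rev ⟨n, hn⟩) s (π (Fin.rev ⟨n, hn⟩) s) s').toReal *
          planningGap M iota hist π n (Nat.le_of_succ_le hn) s')

lemma planningGap_nonneg (M : EpisodicMDP S A H) (iota : ℝ) (hist : History S A H)
    (π : Policy S A H) : ∀ (n : ℕ) (hn : n ≤ H) (s : S), 0 ≤ planningGap M iota hist π n hn s
  | 0, _, _ => le_rfl
  | n + 1, hn, s => by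
    refine le_min zero_le_one (add_nonneg (mul_nonneg zero_le_two (bonus_nonneg _ _ _ _ _))
      (Finset.sum_nonneg fun s' _ => mul_nonneg ENNReal.toReal_nonneg ?_))
    exact planningGap_nonneg M iota hist π n (Nat.le_of_succ_le hn) s'

lemma planningGap_le_one (M : EpisodicMDP S A H) (iota : ℝ) (hist : History S A H)
    (π : Policy S A H) : ∀ (n : ℕ) (hn : n ≤ H) (s : S), planningGap M iota hist π n hn s ≤ 1
  | 0, _, _ => zero_le_one
  | _ + 1, _, _ => min_le_left _ _

/-- One bonus pays for the empirical transitions, the other for the subtraction made by optimism.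
The cut at `0` costs nothing since the empirical mixture is nonnegative. -/
lemma IsAccurate.abs_optimisticBackup_sub_le {M : EpisodicMDP S A H} {iota : ℝ}
    {hist : History S A H} (hacc : IsAccurate M iota hist) (W : SupportWindow M) (n : ℕ)
    (hn : n < H) {ν ν' : S → CDFOn 0 (n : ℝ)} {d : S → ℝ}
    (hd : ∀ s x, |(ν s).val x - (ν' s).val x| ≤ d s) (s : S) (a : A)
    (hN : 0 < visitCount hist (Fin.rev ⟨n, hn⟩) s a) (x : ℝ) :
    |(optimisticBackup M W iota hist n hn ν s a).val x -
        (M.returnBackup n hn ν' s a).val x| ≤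
      2 * bonus iota hist (Fin.rev ⟨n, hn⟩) s a +
        ∑ s', (M.P (Fin.rev ⟨n, hn⟩) s a s').toReal * d s' := by
  set h : Fin H := Fin.rev ⟨n, hn⟩ with hh
  have h1 := abs_le.1 (hacc.abs_sum_sub_sum_le hN
    (fun s' => (ν s').val_nonneg (x - M.r h s a)) fun s' => (ν s').val_le_one _)
  have h2 : |∑ s', (M.P h s a s').toReal * (ν s').val (x - M.r h s a) -
      ∑ s', (M.P h s a s').toReal * (ν' s').val (x - M.r h s a)| ≤
      ∑ s', (M.P h s a s').toReal * d s' := by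
    rw [← Finset.sum_sub_distrib]
    refine (Finset.abs_sum_le_sum_abs _ _).trans (Finset.sum_le_sum fun s' _ => ?_)
    rw [← mul_sub, abs_mul, abs_of_nonneg ENNReal.toReal_nonneg]
    exact mul_le_mul_of_nonneg_left (hd s' _) ENNReal.toReal_nonneg
  have h3 : 0 ≤ (Set.Ico (W.lo h s a) (W.hi h s a)).indicator (fun _ => (1 : ℝ)) x :=
    Set.indicator_nonneg (fun _ _ => zero_le_one) x
  have h4 : (Set.Ico (W.lo h s a) (W.hi h s a)).indicator (fun _ => (1 : ℝ)) x ≤ 1 :=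
    Set.indicator_le_self' (fun _ _ => zero_le_one) x
  have h5 : 0 ≤ ∑ s', (PMF.ofMultiset _ (nextStates_ne_zero hN) s').toReal *
      (ν s').val (x - M.r h s a) :=
    Finset.sum_nonneg fun s' _ => mul_nonneg ENNReal.toReal_nonneg ((ν s').val_nonneg _)
  have hc := bonus_nonneg iota hist h s a
  have h6 := mul_nonneg hc h3
  have h7 := mul_le_of_le_one_right hc h4
  have h8 : (optimisticBackup M W iota hist n hn ν s a).val x =
      max ((∑ s', (PMF.ofMultiset _ (nextStates_ne_zero hN) s').toReal *
          (ν s').val (x - M.r h s a)) - bonus iota hist h s a *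
          (Set.Ico (W.lo h s a) (W.hi h s a)).indicator (fun _ => (1 : ℝ)) x) 0 :=
    optimisticBackup_val_of_pos M W iota hist n hn ν s a hN x
  have h9 : (M.returnBackup n hn ν' s a).val x =
      ∑ s', (M.P h s a s').toReal * (ν' s').val (x - M.r h s a) := rfl
  rw [h8, h9]
  rw [abs_le] at h2 ⊢
  constructor
  · have := le_max_left ((∑ s', (PMF.ofMultiset _ (nextStates_ne_zero hN) s').toReal *
          (ν s').val (x - M.r h s a)) - bonus iota hist h s a *
          (Set.Ico (W.lo h s a) (W.hi h s a)).indicator (fun _ => (1 : ℝ)) x) 0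
    linarith
  · rw [sub_le_iff_le_add]
    refine max_le ?_ ?_
    · linarith
    · linarith

lemma IsAccurate.abs_plannedReturn_sub_le {M : EpisodicMDP S A H} {iota : ℝ}
    {hist : History S A H} (hacc : IsAccurate M iota hist) (W : SupportWindow M)
    (hι : 1 ≤ 2 * √(2 * Fintype.card S * iota)) (π : Policy S A H) :
    ∀ (n : ℕ) (hn : n ≤ H) (s : S) (x : ℝ),
      |(plannedReturn M W iota hist π n hn s).val x - (M.returnDist π n hn s).val x| ≤
        planningGap M iota hist π n hn s
  | 0, _, _, x => (by rw [sub_self, abs_zero] :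
      |(CDFOn.diracRight 0 ((0 : ℕ) : ℝ) (Nat.cast_nonneg _)).val x -
        (CDFOn.diracRight 0 ((0 : ℕ) : ℝ) (Nat.cast_nonneg _)).val x| = 0).le
  | n + 1, hn, s, x => by
    have ih := hacc.abs_plannedReturn_sub_le W hι π n (Nat.le_of_succ_le hn)
    refine le_min (abs_sub_le_of_nonneg_of_le (CDFOn.val_nonneg _ _) (CDFOn.val_le_one _ _)
      (CDFOn.val_nonneg _ _) (CDFOn.val_le_one _ _)) ?_
    by_cases hN : 0 < visitCount hist (Fin.rev ⟨n, hn⟩) s (π (Fin.rev ⟨n, hn⟩) s)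
    · exact hacc.abs_optimisticBackup_sub_le W n hn ih s _ hN x
    · refine (abs_sub_le_of_nonneg_of_le (CDFOn.val_nonneg _ _) (CDFOn.val_le_one _ _)
        (CDFOn.val_nonneg _ _) (CDFOn.val_le_one _ _)).trans ?_
      -- Without visits the bonus uses `N ∨ 1 = 1`, and `hι` makes twice its value exceed the
      -- trivial distance `1`.
      have hb : 1 ≤ 2 * bonus iota hist (Fin.rev ⟨n, hn⟩) s (π (Fin.rev ⟨n, hn⟩) s) := by
        rw [bonus, Nat.eq_zero_of_not_pos hN]
        simpa using hι
      refine hb.trans (le_add_of_nonneg_right ?_)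
      exact Finset.sum_nonneg fun s' _ => mul_nonneg ENNReal.toReal_nonneg
        (planningGap_nonneg M iota hist π n _ s')

/-- The regret of one episode is controlled by the planning gap. -/
lemma IsAccurate.optValue_sub_value_le [Nonempty A] {M : EpisodicMDP S A H} {β iota : ℝ}
    (hβ : β ≠ 0) {hist : History S A H} (hacc : IsAccurate M iota hist) {W : SupportWindow M}
    (hι : 1 ≤ 2 * √(2 * Fintype.card S * iota)) {π : Policy S A H}
    (hπ : IsPlannedPolicy M W β iota hist π) (s : S) :
    M.optValue β s - M.value β π s ≤
      lipConst β H * planningGap M iota hist π H le_rfl s := by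
  have h1 : M.optValue β s ≤ entRM β (plannedReturn M W iota hist π H le_rfl s).law := by
    refine ciSup_le fun π' => ?_
    rw [M.value_eq_entRM_returnDist]
    exact (CDFOn.entRM_law_le_iff _ _).2 (hacc.expMoment_returnDist_le hπ π' H le_rfl s)
  have h2 := (abs_le.1 (abs_entRM_sub_le hβ (hacc.abs_plannedReturn_sub_le W hι π H le_rfl s))).2
  rw [M.value_eq_entRM_returnDist]
  linarith

end Returns

/-! ### Concentration of the empirical transitions. -/

section Concentration

variable {S A : Type*} {H : ℕ}

open Classical in
lemma visitCount_cons (e : Episode S A H) (hist : History S A H) (h : Fin H) (s : S) (a : A) :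
    visitCount (e :: hist) h s a =
      visitCount hist h s a + if e.states h.castSucc = s ∧ e.actions h = a then 1 else 0 := by
  by_cases hv : e.states h.castSucc = s ∧ e.actions h = a <;>
    simp [visitCount, visits, hv]

open Classical in
lemma hitCount_cons (e : Episode S A H) (hist : History S A H) (h : Fin H) (s : S) (a : A)
    (B : Finset S) :
    hitCount (e :: hist) h s a B = hitCount hist h s a B +
      if e.states h.castSucc = s ∧ e.actions h = a then (if e.states h.succ ∈ B then 1 else 0)
      else 0 := by
  by_cases hv : e.states h.castSucc = s ∧ e.actions h = a
  · have h1 : nextStates (e :: hist) h s a = e.states h.succ ::ₘ nextStates hist h s a := by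
      simp [nextStates, visits, hv]
    rw [hitCount, h1, if_pos hv, hitCount]
    simp only [Multiset.count_cons, Finset.sum_add_distrib, Finset.sum_ite_eq']
  · have h1 : nextStates (e :: hist) h s a = nextStates hist h s a := by
      simp [nextStates, visits, hv]
    rw [hitCount, h1, if_neg hv, hitCount, add_zero]

lemma visitCount_le_length (hist : History S A H) (h : Fin H) (s : S) (a : A) :
    visitCount hist h s a ≤ hist.length := List.length_filter_le _ _

/-- The logarithm of the exponential supermartingale for the transitions from `(s, a)` at step `h`
into `B`. -/
noncomputable def hitExponent (M : EpisodicMDP S A H) (h : Fin H) (s : S) (a : A) (B : Finset S)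
    (t : ℝ) (hist : History S A H) : ℝ :=
  t * (hitCount hist h s a B - visitCount hist h s a * ∑ s' ∈ B, (M.P h s a s').toReal) -
    t ^ 2 / 8 * visitCount hist h s a

open Classical in
lemma hitExponent_cons (M : EpisodicMDP S A H) (h : Fin H) (s : S) (a : A) (B : Finset S)
    (t : ℝ) (e : Episode S A H) (hist : History S A H) :
    hitExponent M h s a B t (e :: hist) = hitExponent M h s a B t hist +
      if e.states h.castSucc = s ∧ e.actions h = a then
        t * ((if e.states h.succ ∈ B then 1 else 0) - ∑ s' ∈ B, (M.P h s a s').toReal) - t ^ 2 / 8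
      else 0 := by
  rw [hitExponent, hitExponent, hitCount_cons, visitCount_cons]
  split_ifs <;> push_cast <;> ring

/-- Within one episode only step `h` contributes, and only if it visits `(s, a)`; given that,
Hoeffding's lemma bounds its mean factor by one. The initial state is arbitrary, hence so is Nature.
-/
lemma lexp_exp_hitExponent_cons_le [Fintype S] (M : EpisodicMDP S A H) (h : Fin H) (s : S) (a : A)
    (B : Finset S) (t : ℝ) (π : Policy S A H) (hist : History S A H) (s₁ : S) :
    ((M.episodeLaw π s₁).lexp fun e =>
      ENNReal.ofReal (Real.exp (hitExponent M h s a B t (e :: hist)))) ≤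
      ENNReal.ofReal (Real.exp (hitExponent M h s a B t hist)) := by
  classical
  set q := ∑ s' ∈ B, (M.P h s a s').toReal with hq
  set g : S → ℝ := fun s' => t * ((if s' ∈ B then 1 else 0) - q) - t ^ 2 / 8 with hg
  have key := M.lexp_episodeLaw_prod_le π s₁
    (fun _ => ENNReal.ofReal (Real.exp (hitExponent M h s a B t hist)))
    (fun h' s₀ a₀ s' => if h' = h ∧ s₀ = s ∧ a₀ = a then ENNReal.ofReal (Real.exp (g s')) else 1)
    (fun _ _ _ => 1) (fun _ => rfl) ?_
  · rw [mul_one] at key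
    refine le_trans (le_of_eq ?_) key
    congr 1
    funext e
    rw [Finset.prod_eq_single h (fun h' _ hne => if_neg fun hc => hne hc.1)
      (fun hc => absurd (Finset.mem_univ h) hc), hitExponent_cons, Real.exp_add,
      ENNReal.ofReal_mul (Real.exp_pos _).le]
    congr 1
    by_cases hv : e.states h.castSucc = s ∧ e.actions h = a
    · rw [if_pos hv]
      exact (if_pos ⟨rfl, hv⟩).symm
    · rw [if_neg hv, if_neg fun hc => hv hc.2, Real.exp_zero, ENNReal.ofReal_one]
  · intro n hn s₀
    by_cases hc : Fin.rev ⟨n, hn⟩ = h ∧ s₀ = s ∧ π (Fin.rev ⟨n, hn⟩) s₀ = a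
    · obtain ⟨rfl, rfl, rfl⟩ := hc
      simp only [and_self, if_true, mul_one]
      rw [PMF.lexp_ofReal _ fun _ => (Real.exp_pos _).le]
      refine ENNReal.ofReal_le_one.2 ?_
      have hoeff := (M.P (Fin.rev ⟨n, hn⟩) s₀ (π (Fin.rev ⟨n, hn⟩) s₀)).sum_mul_exp_sub_mean_le
        (fun s' => if s' ∈ B then (1 : ℝ) else 0) 0
        (fun s' => by by_cases hs : s' ∈ B <;> simp [hs]) t
      have hmean : ∑ s', (M.P (Fin.rev ⟨n, hn⟩) s₀ (π (Fin.rev ⟨n, hn⟩) s₀) s').toReal *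
          (if s' ∈ B then (1 : ℝ) else 0) = q := by
        simp [hq, Finset.sum_ite_mem]
      rw [hmean] at hoeff
      simp only [hg, Real.exp_sub, ← mul_div_assoc, ← Finset.sum_div]
      exact (div_le_one (Real.exp_pos _)).2 hoeff
    · simp only [hc, if_false, mul_one, PMF.lexp_const, le_refl]

lemma lexp_runLaw_exp_hitExponent_le [Fintype S] (M : EpisodicMDP S A H)
    (nature : History S A H → PMF S) (alg : History S A H → Policy S A H) (h : Fin H) (s : S)
    (a : A) (B : Finset S) (t : ℝ) (k : ℕ) :
    ((M.runLaw nature alg k).lexp fun hist =>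
      ENNReal.ofReal (Real.exp (hitExponent M h s a B t hist))) ≤ 1 := by
  refine (M.lexp_runLaw_le nature alg _ (fun hist s₁ =>
    lexp_exp_hitExponent_cons_le M h s a B t (alg hist) hist s₁) k).trans (le_of_eq ?_)
  simp [hitExponent, hitCount, nextStates, visitCount, visits]

lemma PMF.toOuterMeasure_exp_ge_le {α : Type*} (p : PMF α) (f : α → ℝ) (c : ℝ)
    (h : (p.lexp fun x => ENNReal.ofReal (Real.exp (f x))) ≤ 1) :
    p.toOuterMeasure {x | c ≤ f x} ≤ ENNReal.ofReal (Real.exp (-c)) := by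
  have hc : ENNReal.ofReal (Real.exp c) ≠ 0 := (ENNReal.ofReal_pos.2 (Real.exp_pos c)).ne'
  have h1 := p.toOuterMeasure_ge_le_lexp_div (fun x => ENNReal.ofReal (Real.exp (f x))) hc
    ENNReal.ofReal_ne_top
  refine (MeasureTheory.OuterMeasure.mono _ fun x hx => ?_).trans
    (h1.trans ((ENNReal.div_le_div_right h _).trans (le_of_eq ?_)))
  · exact ENNReal.ofReal_le_ofReal (Real.exp_le_exp.2 hx)
  · rw [one_div, ← ENNReal.ofReal_inv_of_pos (Real.exp_pos c), Real.exp_neg]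

/-- The probability that the empirical transition probabilities are not accurate at stage `k`. -/
lemma runLaw_not_isAccurate_le [Fintype S] [Fintype A] (M : EpisodicMDP S A H) {iota : ℝ}
    (hι : 0 ≤ iota) (nature : History S A H → PMF S) (alg : History S A H → Policy S A H)
    (K k : ℕ) :
    (M.runLaw nature alg k).toOuterMeasure
        {hist | ¬ IsAccurate M iota hist ∧ hist.length ≤ K} ≤
      ((H * (Fintype.card S * (Fintype.card A * (2 ^ Fintype.card S * K))) : ℕ) : ℝ≥0∞) *
        ENNReal.ofReal (Real.exp (-(4 * Fintype.card S * iota))) := by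
  classical
  set t : ℕ → ℝ := fun n => 4 * √(2 * (Fintype.card S : ℝ) / (n : ℕ) * iota) with ht
  -- The visit count `N` is random while the tilt must be fixed in advance, so there is one
  -- supermartingale for each value `1, …, K` of `N`. The tilt `4c` maximizes `t c - t²/8`.
  have hsub : {hist | ¬ IsAccurate M iota hist ∧ hist.length ≤ K} ⊆
      ⋃ i : Fin H × S × A × Finset S × Fin K, {hist | 4 * Fintype.card S * iota ≤
        hitExponent M i.1 i.2.1 i.2.2.1 i.2.2.2.1 (t (i.2.2.2.2 + 1)) hist} := by
    rintro hist ⟨hacc, hlen⟩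
    simp only [IsAccurate, not_forall, not_le] at hacc
    obtain ⟨h, s, a, hN, B, hB⟩ := hacc
    have hNK := (visitCount_le_length hist h s a).trans hlen
    refine Set.mem_iUnion.2 ⟨(h, s, a, B, ⟨visitCount hist h s a - 1, by omega⟩), ?_⟩
    change 4 * Fintype.card S * iota ≤
      hitExponent M h s a B (t (visitCount hist h s a - 1 + 1)) hist
    rw [Nat.sub_add_cancel hN]
    have hN' : (0 : ℝ) < visitCount hist h s a := Nat.cast_pos.2 hN
    have hb : bonus iota hist h s a =
        √(2 * (Fintype.card S : ℝ) / (visitCount hist h s a : ℕ) * iota) := by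
      rw [bonus, max_eq_left (Nat.succ_le_of_lt hN)]
    have ht' : t (visitCount hist h s a) = 4 * bonus iota hist h s a := by rw [hb]
    have hsq : bonus iota hist h s a ^ 2 * visitCount hist h s a = 2 * Fintype.card S * iota := by
      rw [hb, Real.sq_sqrt (by positivity)]
      field_simp
    rw [ht', hitExponent]
    -- The exponent is at least `4c · Nc - 2c²N = 2c²N = 4Sι`.
    nlinarith [mul_le_mul_of_nonneg_left hB.le (bonus_nonneg iota hist h s a)]
  refine (MeasureTheory.measure_mono hsub).trans
    ((MeasureTheory.measure_iUnion_fintype_le _ _).trans ?_)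
  refine (Finset.sum_le_sum fun i _ => PMF.toOuterMeasure_exp_ge_le _ _ _
    (lexp_runLaw_exp_hitExponent_le M nature alg _ _ _ _ _ k)).trans (le_of_eq ?_)
  rw [Finset.sum_const, nsmul_eq_mul, Finset.card_univ]
  simp only [Fintype.card_prod, Fintype.card_fin, Fintype.card_finset]

/-! ### Planning gaps against bonuses along the trajectories. -/

/-- The sum of the planning gaps over the episodes. -/
noncomputable def cumGap [Fintype S] (M : EpisodicMDP S A H) (iota : ℝ)
    (alg : History S A H → Policy S A H) : History S A H → ℝ
  | [] => 0
  | e :: hist => cumGap M iota alg hist + planningGap M iota hist (alg hist) H le_rfl (e.states 0)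

/-- Twice the sum of the bonuses along the episodes. -/
noncomputable def cumBonus [Fintype S] (iota : ℝ) : History S A H → ℝ
  | [] => 0
  | e :: hist => cumBonus iota hist +
      ∑ h : Fin H, 2 * bonus iota hist h (e.states h.castSucc) (e.actions h)

/-- The logarithm of the exponential supermartingale for the planning gaps. -/
noncomputable def gapExponent [Fintype S] (M : EpisodicMDP S A H) (iota : ℝ)
    (alg : History S A H → Policy S A H) (t : ℝ) (hist : History S A H) : ℝ :=
  t * (cumGap M iota alg hist - cumBonus iota hist) - hist.length * (H * (t ^ 2 / 8))

/-- With `n` steps left, `exp (-t G_n + n t²/8)` dominates the mean of the exponential of `-t` times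
the remaining doubled bonuses: each step uses `G_{n+1} ≤ 2c + P G_n` and Hoeffding's lemma. The
truncation at `1` is what keeps its cost at `t²/8`. -/
lemma lexp_exp_gapExponent_cons_le [Fintype S] (M : EpisodicMDP S A H) (iota : ℝ)
    (alg : History S A H → Policy S A H) {t : ℝ} (ht : 0 ≤ t) (hist : History S A H) (s₁ : S) :
    ((M.episodeLaw (alg hist) s₁).lexp fun e =>
      ENNReal.ofReal (Real.exp (gapExponent M iota alg t (e :: hist)))) ≤
      ENNReal.ofReal (Real.exp (gapExponent M iota alg t hist)) := by
  set π := alg hist with hπ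
  have key := M.lexp_episodeLaw_prod_le π s₁
    (fun s => ENNReal.ofReal (Real.exp (gapExponent M iota alg t hist +
      t * planningGap M iota hist π H le_rfl s - H * (t ^ 2 / 8))))
    (fun h s a _ => ENNReal.ofReal (Real.exp (-t * (2 * bonus iota hist h s a))))
    (fun n hn s => ENNReal.ofReal (Real.exp (-t * planningGap M iota hist π n hn s +
      n * (t ^ 2 / 8)))) (fun s => ?_) ?_
  · rw [← ENNReal.ofReal_mul (Real.exp_pos _).le, ← Real.exp_add] at key
    have h1 : gapExponent M iota alg t hist + t * planningGap M iota hist π H le_rfl s₁ -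
        H * (t ^ 2 / 8) + (-t * planningGap M iota hist π H le_rfl s₁ + H * (t ^ 2 / 8)) =
        gapExponent M iota alg t hist := by ring
    rw [h1] at key
    refine le_trans (le_of_eq ?_) key
    congr 1
    funext e
    rw [← ENNReal.ofReal_prod_of_nonneg fun _ _ => (Real.exp_pos _).le, ← Real.exp_sum,
      ← ENNReal.ofReal_mul (Real.exp_pos _).le, ← Real.exp_add, ← Finset.mul_sum]
    congr 2
    rw [gapExponent, gapExponent, cumGap, cumBonus, List.length_cons, ← hπ]
    push_cast
    ring
  · simp [planningGap]
  · intro n hn s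
    set a := π (Fin.rev ⟨n, hn⟩) s with ha
    set p := M.P (Fin.rev ⟨n, hn⟩) s a with hp
    set G := planningGap M iota hist π n hn.le with hG
    rw [PMF.lexp_const_mul, PMF.lexp_ofReal _ fun _ => (Real.exp_pos _).le,
      ← ENNReal.ofReal_mul (Real.exp_pos _).le]
    refine ENNReal.ofReal_le_ofReal ?_
    have hoeff := p.sum_mul_exp_sub_mean_le G 0 (fun s' => ⟨planningGap_nonneg _ _ _ _ _ _ _, by
      rw [zero_add]; exact planningGap_le_one _ _ _ _ _ _ _⟩) (-t)
    set m := ∑ s', (p s').toReal * G s' with hm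
    have h2 : ∑ s', (p s').toReal * Real.exp (-t * G s' + n * (t ^ 2 / 8)) =
        Real.exp (-t * m + n * (t ^ 2 / 8)) *
          ∑ s', (p s').toReal * Real.exp (-t * (G s' - m)) := by
      rw [Finset.mul_sum]
      refine Finset.sum_congr rfl fun s' _ => ?_
      rw [mul_left_comm, ← Real.exp_add]
      congr 2
      ring
    rw [h2, ← mul_assoc, ← Real.exp_add]
    refine (mul_le_mul_of_nonneg_left hoeff (Real.exp_pos _).le).trans ?_
    rw [← Real.exp_add]
    refine Real.exp_le_exp.2 ?_
    have h3 : planningGap M iota hist π (n + 1) hn s ≤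
        2 * bonus iota hist (Fin.rev ⟨n, hn⟩) s a + m := min_le_right _ _
    have h4 := mul_le_mul_of_nonneg_left h3 ht
    push_cast
    linarith

/-- Deviation bound for the planning gaps. -/
lemma runLaw_cumGap_ge_le [Fintype S] (M : EpisodicMDP S A H) (iota : ℝ)
    (nature : History S A H → PMF S) (alg : History S A H → Policy S A H) {K : ℕ}
    (hH : 1 ≤ H) (hK : 1 ≤ K) (hι : 0 ≤ iota) :
    (M.runLaw nature alg K).toOuterMeasure
      {hist | cumBonus iota hist + √(K * H * iota) ≤ cumGap M iota alg hist} ≤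
      ENNReal.ofReal (Real.exp (-(2 * iota))) := by
  have hH' : (0 : ℝ) < H := by exact_mod_cast hH
  have hK' : (0 : ℝ) < K := by exact_mod_cast hK
  set x := √(K * H * iota) with hx
  have hx0 : 0 ≤ x := Real.sqrt_nonneg _
  have hx2 : x ^ 2 = K * H * iota := Real.sq_sqrt (by positivity)
  -- The maximizer of `t x - KH t²/8`, whose maximum is `2x²/(KH) = 2ι`.
  set t := 4 * x / (K * H) with ht
  have ht0 : 0 ≤ t := by positivity
  have hmart := M.lexp_runLaw_le nature alg
    (fun hist => ENNReal.ofReal (Real.exp (gapExponent M iota alg t hist)))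
    (fun hist s₁ => lexp_exp_gapExponent_cons_le M iota alg ht0 hist s₁) K
  have h0 : gapExponent M iota alg t [] = 0 := by simp [gapExponent, cumGap, cumBonus]
  rw [h0, Real.exp_zero, ENNReal.ofReal_one] at hmart
  refine (PMF.toOuterMeasure_mono _ ?_).trans
    (PMF.toOuterMeasure_exp_ge_le _ (gapExponent M iota alg t) (2 * iota) hmart)
  rintro hist ⟨hle, hsupp⟩
  have hle' : cumBonus iota hist + x ≤ cumGap M iota alg hist := hle
  have hlen := M.length_of_mem_support_runLaw nature alg K hist hsupp
  change 2 * iota ≤ gapExponent M iota alg t hist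
  rw [gapExponent, hlen]
  have h1 := mul_le_mul_of_nonneg_left (show x ≤ cumGap M iota alg hist - cumBonus iota hist by
    linarith) ht0
  have h2 : t * x = 4 * iota := by
    rw [ht, div_mul_eq_mul_div, mul_assoc, ← sq, hx2]
    field_simp
  have h3 : (K : ℝ) * (H * (t ^ 2 / 8)) = 2 * iota := by
    rw [ht, div_pow, mul_pow, hx2]
    field_simp
    ring
  linarith

/-- Each episode is planned from the suffix preceding it, so accuracy is required of the suffixes.
-/
lemma regret_le_cumGap [Fintype S] [Nonempty A] {M : EpisodicMDP S A H} {W : SupportWindow M} {β iota : ℝ}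
    (hβ : β ≠ 0) (hι : 1 ≤ 2 * √(2 * Fintype.card S * iota))
    {alg : History S A H → Policy S A H} (halg : IsRODIMF M W β iota alg)
    (hist : History S A H) (hacc : ∀ t, t <:+ hist → IsAccurate M iota t) :
    M.regret β alg hist ≤ lipConst β H * cumGap M iota alg hist := by
  induction hist with
  | nil => simp [EpisodicMDP.regret, cumGap]
  | cons e hist ih =>
    have h1 := ih fun t ht => hacc t (ht.trans (List.suffix_cons e hist))
    have h2 := (hacc hist (List.suffix_cons e hist)).optValue_sub_value_le hβ hι (halg hist)
      (e.states 0)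
    rw [EpisodicMDP.regret, cumGap, mul_add]
    linarith

/-- Covers the case of one action, in which `ι` can be arbitrarily close to zero. -/
lemma regret_eq_zero_of_subsingleton [Subsingleton A] (M : EpisodicMDP S A H) (β : ℝ)
    (alg : History S A H → Policy S A H) (hist : History S A H) : M.regret β alg hist = 0 := by
  induction hist with
  | nil => rfl
  | cons e hist ih =>
    rw [EpisodicMDP.regret, ih, EpisodicMDP.optValue, ciSup_subsingleton (alg hist)]
    ring

end Concentration

/-! ### Summing the bonuses. -/

section Counting

/-- Makes the bonuses telescope. The `3` comes from `√(n+1) + √n ≤ 3√n` for `n ≥ 1`. -/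
lemma inv_sqrt_max_one_le (n : ℕ) :
    (√((max n 1 : ℕ) : ℝ))⁻¹ ≤ 3 * (√((n + 1 : ℕ) : ℝ) - √(n : ℝ)) := by
  rcases Nat.eq_zero_or_pos n with rfl | hn
  · norm_num
  · rw [max_eq_left (Nat.succ_le_of_lt hn)]
    have hn' : (1 : ℝ) ≤ n := by exact_mod_cast hn
    have h1 : 0 < √(n : ℝ) := Real.sqrt_pos.2 (by linarith)
    have h2 : √(n : ℝ) ^ 2 = n := Real.sq_sqrt (by linarith)
    have h3 : √((n + 1 : ℕ) : ℝ) ^ 2 = n + 1 := by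
      rw [Real.sq_sqrt (Nat.cast_nonneg _)]; push_cast; ring
    have h4 : 0 ≤ √((n + 1 : ℕ) : ℝ) := Real.sqrt_nonneg _
    have h5 : √((n + 1 : ℕ) : ℝ) ≤ 2 * √(n : ℝ) := by
      refine Real.sqrt_le_iff.2 ⟨by positivity, ?_⟩
      rw [mul_pow, h2]; push_cast; linarith
    rw [inv_le_iff_one_le_mul₀ h1]
    have h6 : (√((n + 1 : ℕ) : ℝ) - √(n : ℝ)) * (√((n + 1 : ℕ) : ℝ) + √(n : ℝ)) = 1 := by
      ring_nf
      rw [h2, add_comm 1 n, h3]; ring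
    have h7 : 0 ≤ √((n + 1 : ℕ) : ℝ) - √(n : ℝ) :=
      sub_nonneg.2 (Real.sqrt_le_sqrt (by push_cast; linarith))
    nlinarith [mul_nonneg h7 (show 0 ≤ 2 * √(n : ℝ) - √((n + 1 : ℕ) : ℝ) by linarith)]

variable {S A : Type*} {H : ℕ} [Fintype S] [Fintype A]

lemma sum_visitCount (hist : History S A H) (h : Fin H) :
    ∑ p : S × A, visitCount hist h p.1 p.2 = hist.length := by
  classical
  induction hist with
  | nil => simp [visitCount, visits]
  | cons e hist ih =>
    simp only [visitCount_cons, Finset.sum_add_distrib, ih, List.length_cons]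
    congr 1
    rw [Finset.sum_eq_single (e.states h.castSucc, e.actions h)]
    · simp
    · rintro ⟨s, a⟩ - hne
      exact if_neg fun hc => hne (by rw [hc.1, hc.2])
    · exact fun hc => absurd (Finset.mem_univ _) hc

/-- The potential `∑ √N` changes only at the visited pair, by `√(N+1) - √N`. -/
lemma bonus_le {iota : ℝ} (hι : 0 ≤ iota) (e : Episode S A H) (hist : History S A H)
    (h : Fin H) :
    bonus iota hist h (e.states h.castSucc) (e.actions h) ≤
      3 * √(2 * Fintype.card S * iota) *
        (∑ p : S × A, √(visitCount (e :: hist) h p.1 p.2 : ℝ) -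
          ∑ p : S × A, √(visitCount hist h p.1 p.2 : ℝ)) := by
  classical
  have h1 : ∑ p : S × A, √(visitCount (e :: hist) h p.1 p.2 : ℝ) -
      ∑ p : S × A, √(visitCount hist h p.1 p.2 : ℝ) =
      √((visitCount hist h (e.states h.castSucc) (e.actions h) + 1 : ℕ) : ℝ) -
        √(visitCount hist h (e.states h.castSucc) (e.actions h) : ℝ) := by
    rw [← Finset.sum_sub_distrib, Finset.sum_eq_single (e.states h.castSucc, e.actions h)]
    · rw [visitCount_cons, if_pos ⟨rfl, rfl⟩]
    · rintro ⟨s, a⟩ - hne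
      rw [visitCount_cons, if_neg fun hc => hne (by rw [hc.1, hc.2]), add_zero, sub_self]
    · exact fun hc => absurd (Finset.mem_univ _) hc
  rw [h1, bonus, div_mul_eq_mul_div, Real.sqrt_div (by positivity), div_eq_mul_inv]
  have := mul_le_mul_of_nonneg_left
    (inv_sqrt_max_one_le (visitCount hist h (e.states h.castSucc) (e.actions h)))
    (Real.sqrt_nonneg (2 * Fintype.card S * iota))
  linarith

lemma cumBonus_le_sum {iota : ℝ} (hι : 0 ≤ iota) (hist : History S A H) :
    cumBonus iota hist ≤ 6 * √(2 * Fintype.card S * iota) *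
      ∑ h : Fin H, ∑ p : S × A, √(visitCount hist h p.1 p.2 : ℝ) := by
  induction hist with
  | nil => simp [cumBonus, visitCount, visits]
  | cons e hist ih =>
    have h1 : ∑ h : Fin H, 2 * bonus iota hist h (e.states h.castSucc) (e.actions h) ≤
        6 * √(2 * Fintype.card S * iota) *
          (∑ h : Fin H, ∑ p : S × A, √(visitCount (e :: hist) h p.1 p.2 : ℝ) -
            ∑ h : Fin H, ∑ p : S × A, √(visitCount hist h p.1 p.2 : ℝ)) := by
      rw [← Finset.sum_sub_distrib, Finset.mul_sum]
      refine Finset.sum_le_sum fun h _ => ?_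
      have := bonus_le hι e hist h
      linarith
    rw [cumBonus]
    linarith

/-- Cauchy-Schwarz, since the counts at a step add up to the number of episodes. -/
lemma sum_sqrt_visitCount_le (hist : History S A H) (h : Fin H) :
    ∑ p : S × A, √(visitCount hist h p.1 p.2 : ℝ) ≤
      √(Fintype.card S * Fintype.card A * hist.length) := by
  refine Real.le_sqrt_of_sq_le ?_
  refine (sq_sum_le_card_mul_sum_sq (s := Finset.univ)
    (f := fun p : S × A => √(visitCount hist h p.1 p.2 : ℝ))).trans (le_of_eq ?_)
  simp only [Real.sq_sqrt (Nat.cast_nonneg _)]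
  rw [← Nat.cast_sum, sum_visitCount, Finset.card_univ, Fintype.card_prod]
  push_cast
  ring

lemma cumBonus_le {iota : ℝ} (hι : 0 ≤ iota) (hist : History S A H) :
    cumBonus iota hist ≤ 6 * √(2 * Fintype.card S * iota) *
      (H * √(Fintype.card S * Fintype.card A * hist.length)) := by
  refine (cumBonus_le_sum hι hist).trans (mul_le_mul_of_nonneg_left ?_ (by positivity))
  refine (Finset.sum_le_sum fun h _ => sum_sqrt_visitCount_le hist h).trans (le_of_eq ?_)
  rw [Finset.sum_const, Finset.card_univ, Fintype.card_fin, nsmul_eq_mul]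

end Counting

/-! ### Failure probabilities and the final bound. -/

lemma exp_neg_logFactor {S A : Type*} [Fintype S] [Fintype A] [Nonempty S] [Nonempty A] {H K : ℕ}
    (hH : 1 ≤ H) (hK : 1 ≤ K) {δ : ℝ} (hδ : 0 < δ) :
    Real.exp (-logFactor S A H K δ) =
      δ / ((Fintype.card S : ℝ) * Fintype.card A * (K * H)) := by
  have hS : (0 : ℝ) < Fintype.card S := by exact_mod_cast Fintype.card_pos
  have hA : (0 : ℝ) < Fintype.card A := by exact_mod_cast Fintype.card_pos
  have hH' : (0 : ℝ) < H := by exact_mod_cast hH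
  have hK' : (0 : ℝ) < K := by exact_mod_cast hK
  rw [Real.exp_neg, logFactor, Real.exp_log (by positivity), inv_div]

/-- Absorbs the `2^S` subsets of the union bound, with `S = n + 1` and `x = e^{-ι}`. -/
lemma two_mul_pow_mul_le {x : ℝ} (hx : 0 ≤ x) (hx' : x ≤ 1 / 2) (n : ℕ) :
    2 ^ (n + 1) * x ^ (4 * (n + 1)) ≤ 2 * x ^ 4 := by
  have h1 : x ^ 4 ≤ (1 / 2) ^ 4 := pow_le_pow_left₀ hx hx' 4
  have h2 : (2 * x ^ 4) ^ n ≤ 1 := pow_le_one₀ (by positivity) (by norm_num at h1; linarith)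
  have h3 : 2 ^ (n + 1) * x ^ (4 * (n + 1)) = (2 * x ^ 4) ^ n * (2 * x ^ 4) := by
    rw [pow_mul, ← mul_pow, pow_succ]
  rw [h3]
  exact mul_le_of_le_one_left (by positivity) h2

/-- The regret bound, when there are at least two actions. -/
lemma one_sub_le_runLaw_regret_le {S A : Type*} [Fintype S] [Fintype A] [Nonempty S] [Nonempty A]
    {H K : ℕ} (hH : 1 ≤ H) (hK : 1 ≤ K) (hA : 2 ≤ Fintype.card A) (M : EpisodicMDP S A H)
    (W : SupportWindow M) {β : ℝ} (hβ : β ≠ 0) {δ : ℝ} (hδ : 0 < δ) (hδ' : δ < 1)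
    (nature : History S A H → PMF S) (alg : History S A H → Policy S A H)
    (halg : IsRODIMF M W β (logFactor S A H K δ) alg) :
    ENNReal.ofReal (1 - δ) ≤ (M.runLaw nature alg K).toOuterMeasure
      {hist | M.regret β alg hist ≤ 10 * (lipConst β H * H *
        √((Fintype.card S : ℝ) ^ 2 * Fintype.card A * K * logFactor S A H K δ))} := by
  set ι := logFactor S A H K δ with hι
  set s : ℝ := ((Fintype.card S : ℕ) : ℝ) with hs
  set a : ℝ := ((Fintype.card A : ℕ) : ℝ) with ha
  have hs1 : 1 ≤ s := by rw [hs]; exact_mod_cast Fintype.card_pos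
  have ha2 : 2 ≤ a := by rw [ha]; exact_mod_cast hA
  have hH' : (1 : ℝ) ≤ H := by exact_mod_cast hH
  have hK' : (1 : ℝ) ≤ K := by exact_mod_cast hK
  set y : ℝ := s * a * (K * H) with hy
  have hKH : (1 : ℝ) ≤ K * H := one_le_mul_of_one_le_of_one_le hK' hH'
  have hsa : 2 ≤ s * a := by nlinarith
  have hy2 : 2 * K ≤ y := by
    have : (K : ℝ) ≤ K * H := le_mul_of_one_le_right (by linarith) hH'
    rw [hy]; nlinarith
  have hy0 : 0 < y := by linarith
  set x : ℝ := δ / y with hx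
  have hx0 : 0 < x := div_pos hδ hy0
  have hxy : y * x = δ := by rw [hx]; field_simp
  have hx2 : x ≤ 1 / 2 := by
    rw [hx, div_le_div_iff₀ hy0 two_pos]; linarith
  have hexp : Real.exp (-ι) = x := exp_neg_logFactor hH hK hδ
  have hι0 : Real.log 2 ≤ ι := by
    rw [hι, logFactor]
    refine Real.log_le_log two_pos ?_
    rw [le_div_iff₀ hδ]
    change 2 * δ ≤ y
    linarith
  have hlog2 := Real.log_two_gt_d9
  have hι1 : 0 ≤ ι := by linarith
  -- Two actions force `ι ≥ log 2`, hence `2sι ≥ 1`.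
  have hbonus : 1 ≤ 2 * √(2 * s * ι) := by
    have : 1 ≤ √(2 * s * ι) := by
      rw [Real.one_le_sqrt]
      nlinarith
    linarith
  set B : Set (History S A H) := {hist | ¬ IsAccurate M ι hist ∧ hist.length ≤ K} with hB
  set good : Set (History S A H) := {hist | M.regret β alg hist ≤ 10 * (lipConst β H * H *
    √(s ^ 2 * a * K * ι))} with hgood
  set E₁ : Set (History S A H) := {hist | ∃ t ∈ B, t <:+ hist} with hE₁
  set E₂ : Set (History S A H) :=
    {hist | cumBonus ι hist + √(K * H * ι) ≤ cumGap M ι alg hist} with hE₂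
  have hsub : goodᶜ ∩ (M.runLaw nature alg K).support ⊆ E₁ ∪ E₂ := by
    rintro hist ⟨hbad, hsupp⟩
    by_contra hc
    rw [Set.mem_union, not_or] at hc
    obtain ⟨h1, h2⟩ := hc
    refine hbad ?_
    have hlen := M.length_of_mem_support_runLaw nature alg K hist hsupp
    have hacc : ∀ t, t <:+ hist → IsAccurate M ι t := by
      intro t ht
      by_contra hna
      exact h1 ⟨t, ⟨hna, hlen ▸ ht.length_le⟩, ht⟩
    have h3 := regret_le_cumGap hβ hbonus halg hist hacc
    have h4 : cumGap M ι alg hist < cumBonus ι hist + √(K * H * ι) := not_le.1 h2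
    have h5 := cumBonus_le hι1 hist
    rw [hlen, ← hs, ← ha] at h5
    have h6 : √(2 * s * ι) * √(s * a * K) = √2 * √(s ^ 2 * a * K * ι) := by
      rw [← Real.sqrt_mul (by positivity), ← Real.sqrt_mul (by positivity)]
      congr 1
      ring
    have h7 : √(K * H * ι) ≤ H * √(s ^ 2 * a * K * ι) := by
      refine Real.sqrt_le_iff.2 ⟨by positivity, ?_⟩
      rw [mul_pow, Real.sq_sqrt (by positivity)]
      have e1 : (1 : ℝ) ≤ s ^ 2 * a := by nlinarith
      have e2 : (H : ℝ) ≤ H ^ 2 := by nlinarith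
      have e3 : 0 ≤ K * ι := by positivity
      calc K * H * ι = H * (1 * (K * ι)) := by ring
        _ ≤ H ^ 2 * (s ^ 2 * a * (K * ι)) := by gcongr
        _ = _ := by ring
    have h8 : √2 ≤ 3 / 2 := Real.sqrt_le_iff.2 ⟨by norm_num, by norm_num⟩
    have h9 : 0 ≤ H * √(s ^ 2 * a * K * ι) := by positivity
    have h10 : 6 * √(2 * s * ι) * (H * √(s * a * K)) =
        6 * (√2 * (H * √(s ^ 2 * a * K * ι))) := by
      linear_combination 6 * (H : ℝ) * h6
    have h11 := mul_le_mul_of_nonneg_right h8 h9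
    -- `6√2 ≤ 9` from the bonuses, plus `1` from the deviation term.
    have h12 : cumGap M ι alg hist ≤ 10 * (H * √(s ^ 2 * a * K * ι)) := by linarith
    have h13 := mul_le_mul_of_nonneg_left h12 (lipConst_nonneg β H)
    change M.regret β alg hist ≤ 10 * (lipConst β H * H * √(s ^ 2 * a * K * ι))
    linarith
  have hE₂le : (M.runLaw nature alg K).toOuterMeasure E₂ ≤ ENNReal.ofReal (δ / 2) := by
    refine (runLaw_cumGap_ge_le M ι nature alg hH hK hι1).trans (ENNReal.ofReal_le_ofReal ?_)
    have : Real.exp (-(2 * ι)) = x * x := by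
      rw [← hexp, ← Real.exp_add]; congr 1; ring
    rw [this]
    have : x ≤ δ := by nlinarith
    nlinarith
  have hE₁le : (M.runLaw nature alg K).toOuterMeasure E₁ ≤ ENNReal.ofReal (δ / 2) := by
    refine (M.runLaw_exists_suffix_le nature alg B _
      (fun k => runLaw_not_isAccurate_le M hι1 nature alg K k) K).trans ?_
    rw [← mul_assoc, ← Nat.cast_mul, ← ENNReal.ofReal_natCast,
      ← ENNReal.ofReal_mul (Nat.cast_nonneg _)]
    refine ENNReal.ofReal_le_ofReal ?_
    obtain ⟨n, hn⟩ : ∃ n, Fintype.card S = n + 1 :=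
      Nat.exists_eq_succ_of_ne_zero Fintype.card_ne_zero
    have h1 : Real.exp (-(4 * Fintype.card S * ι)) = x ^ (4 * (n + 1)) := by
      rw [← hexp, ← Real.exp_nat_mul, hn]
      congr 1
      push_cast
      ring
    have h2 := two_mul_pow_mul_le hx0.le hx2 n
    rw [h1]
    push_cast
    rw [← hs, ← ha, hn]
    have h3 : ((K : ℝ) + 1) ≤ y := by linarith
    -- The union runs over `K + 1` stages, steps, pairs, subsets and counts. Two factors `y` absorb
    -- everything but `2^S`, and `y x = δ` turns them into `δ²`.
    calc ((K : ℝ) + 1) * (H * (s * (a * (2 ^ (n + 1) * K)))) * x ^ (4 * (n + 1))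
        = (K + 1) * y * (2 ^ (n + 1) * x ^ (4 * (n + 1))) := by rw [hy]; ring
      _ ≤ y * y * (2 * x ^ 4) := by gcongr
      _ = (y * x) ^ 2 * (2 * x ^ 2) := by ring
      _ ≤ δ / 2 := by
        rw [hxy]
        have e1 : x ^ 2 ≤ (1 / 2) ^ 2 := pow_le_pow_left₀ hx0.le hx2 2
        nlinarith
  have hcompl : (M.runLaw nature alg K).toOuterMeasure goodᶜ ≤ ENNReal.ofReal δ := by
    refine (PMF.toOuterMeasure_mono _ hsub).trans ((MeasureTheory.measure_union_le _ _).trans ?_)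
    refine (add_le_add hE₁le hE₂le).trans (le_of_eq ?_)
    rw [← ENNReal.ofReal_add (by linarith) (by linarith), add_halves]
  rw [ENNReal.ofReal_sub _ hδ.le, ENNReal.ofReal_one, tsub_le_iff_right,
    ← (M.runLaw nature alg K).toOuterMeasure_add_compl good]
  exact add_le_add_right hcompl _

theorem mainTheorem1 :
    (∀ (β : ℝ) (H : ℕ), β ≠ 0 → 1 ≤ H →
      IsLeast {L : ℝ | 0 ≤ L ∧ ∀ F G : CDFOn 0 (H : ℝ),
        |entRM β F.law - entRM β G.law| ≤ L * F.supDist G} (lipConst β H)) ∧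
    ∃ C : ℝ, 0 < C ∧
      ∀ (S A : Type*) [Fintype S] [Fintype A] [Nonempty S] [Nonempty A]
        (H K : ℕ) (_ : 1 ≤ H) (_ : 1 ≤ K) (M : EpisodicMDP S A H) (W : SupportWindow M)
        (β : ℝ) (_ : β ≠ 0) (δ : ℝ) (_ : 0 < δ) (_ : δ < 1)
        (nature : History S A H → PMF S) (alg : History S A H → Policy S A H)
        (_ : IsRODIMF M W β (logFactor S A H K δ) alg),
        ENNReal.ofReal (1 - δ) ≤ (M.runLaw nature alg K).toOuterMeasure
          {hist |
            M.regret β alg hist ≤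
              C * (lipConst β H * H *
                √((Fintype.card S : ℝ) ^ 2 * Fintype.card A * K * logFactor S A H K δ)) ∧
            M.regret β alg hist ≤
              C * ((Real.exp (|β| * H) - 1) / |β| * H *
                √((Fintype.card S : ℝ) ^ 2 * Fintype.card A * K)) *
                √(logFactor S A H K δ)} := by
  refine ⟨fun β H hβ _ => isLeast_lipConst hβ H, 10, by norm_num, ?_⟩
  intro S A _ _ _ _ H K hH hK M W β hβ δ hδ hδ' nature alg halg
  have heq : ∀ hist, M.regret β alg hist ≤ 10 * (lipConst β H * H *
        √((Fintype.card S : ℝ) ^ 2 * Fintype.card A * K * logFactor S A H K δ)) →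
      M.regret β alg hist ≤ 10 * (lipConst β H * H *
        √((Fintype.card S : ℝ) ^ 2 * Fintype.card A * K * logFactor S A H K δ)) ∧
      M.regret β alg hist ≤ 10 * ((Real.exp (|β| * H) - 1) / |β| * H *
        √((Fintype.card S : ℝ) ^ 2 * Fintype.card A * K)) * √(logFactor S A H K δ) := by
    intro hist h
    refine ⟨h, h.trans (le_of_eq ?_)⟩
    rw [Real.sqrt_mul (by positivity), lipConst]
    ring
  -- With a single action the regret vanishes; otherwise `ι` is bounded below as the concentration
  -- argument needs.
  rcases Nat.lt_or_ge (Fintype.card A) 2 with hA | hA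
  · have : Subsingleton A := Fintype.card_le_one_iff_subsingleton.1 (by omega)
    have hle : (1 : ℝ≥0∞) ≤ (M.runLaw nature alg K).toOuterMeasure Set.univ := by
      rw [((M.runLaw nature alg K).toOuterMeasure_apply_eq_one_iff Set.univ).2
        (Set.subset_univ _)]
    refine (ENNReal.ofReal_le_one.2 (by linarith)).trans
      (hle.trans (MeasureTheory.measure_mono fun hist _ => heq hist ?_))
    rw [regret_eq_zero_of_subsingleton]
    have := lipConst_nonneg β H
    positivity
  · exact (one_sub_le_runLaw_regret_le hH hK hA M W hβ hδ hδ' nature alg halg).trans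
      (MeasureTheory.measure_mono heq)
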